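/- Let $P$ be a regular pentagon whose sides, in counterclockwise order, are labelled $1,3,5,2,4$, and let the double pentagon be the translation surface obtained from $P$ and $-P$ by gluing each side of $P$ to the parallel side of $-P$ by a parallel translation (glued sides have the same label). Directions are points of $\mathbb{RP}^1$, identified with the absolute of the hyperbolic plane. For a closed linear trajectory that avoids the vertices and is traversed once, its symbolic orbit is the cyclic word of labels of the consecutively crossed sides. A symbolic orbit of a direction is called short (long) if its length is the smallest (largest) among the symbolic orbits of this direction. The directions $d_1,\dots,d_5$ of the sides with the labels $1,\dots,5$ are, in this cyclic order, the vertices of a regular ideal pentagon, the pentagon of generation $0$. Reflect it in its edge $(d_1,d_5)$ to get the pentagon of generation $1$ with the vertices $\alpha=d_1,\alpha_1,\alpha_2,\alpha_3,d_5$ in order. Inductively, if $v_0,\dots,v_4$ are the vertices of the pentagon of generation $k$ bounded by the arc with the indices $n_1\dots n_{k-1}$ (so that $v_0$ and $v_4$ are the ends of this arc, for $k=1$ of the arc $(d_1,d_5)$), then its reflection in the edge $(v_n,v_{n+1})$, $0\le n\le 3$, with the vertices listed from $v_n$ to $v_{n+1}$, is the pentagon of generation $k+1$ bounded by the arc with the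 indices $n_1\dots n_{k-1}n$; and $\alpha_{n_1\dots n_k}:=v_{n_k}$. Theorem. Let $k\ge 2$, $0\le n_i\le 3$ for $1\le i\le k$, and $n_k\ne 0$. Consider a short (respectively, long) symbolic orbit of the direction $\alpha_{n_1n_2\dots n_k}$. Keep only its sandwiched symbols, that is, those whose two neighbours in the cyclic word are equal, delete all the others, and add $4-n_1$ modulo $5$ to every remaining symbol. The resulting cyclic word is the unique short (respectively, long) symbolic orbit of the direction $\alpha_{3-n_2,\dots,3-n_{k-1},4-n_k}$ (which is $\alpha_{4-n_2}$ for $k=2$). -/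

import Mathlib

/-! # The double pentagon, its closed linear trajectories, and the periodic directions

Vectors and points of the plane are complex numbers.  Side labels are elements of `ZMod 5`; the
label `5` of the last side is `0 : ZMod 5`. -/

namespace DoublePentagon

noncomputable section

/-! ## The surface -/

/-- The unit outer normal of side `s` of the first pentagon `P`.  Consecutive labels differ by a
rotation by `216°`, so counterclockwise around `P` the sides are labelled `1, 3, 5, 2, 4`, and the
lines parallel to the sides `1, 2, 3, 4, 5`, in this order, turn by `36°` each time. -/
def outer (s : ZMod 5) : ℂ :=
  Complex.exp (((6 * Real.pi / 5 * (s.val : ℝ) : ℝ) : ℂ) * Complex.I)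

/-- The side of `P` with label `s`, without its endpoints.  Here `P` is the regular pentagon
inscribed in the unit circle. -/
def side (s : ZMod 5) : Set ℂ :=
  openSegment ℝ (outer s * Complex.exp (((-(Real.pi / 5) : ℝ) : ℂ) * Complex.I))
    (outer s * Complex.exp (((Real.pi / 5 : ℝ) : ℂ) * Complex.I))

/-- The second pentagon of the surface is `-P`.  The parallel translation that takes side `s` of
`P` to the parallel side of `-P`; the double pentagon is `P ∪ -P` with these sides identified. -/
def glue (s : ZMod 5) (z : ℂ) : ℂ :=
  z - ((2 * Real.cos (Real.pi / 5) : ℝ) : ℂ) * outer s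

/-! ## Closed trajectories and symbolic orbits -/

/-- A closed linear trajectory on the double pentagon with direction vector `v`, not through the
vertices, recorded by its consecutive crossings with the sides: `label i` is the side that is
crossed and `point i` is the crossing point, seen on the boundary of `P`.  The trajectory runs
alternately in `P` (from crossing `i` to `i + 1` for even `i`) and in `-P` (for odd `i`), and
`period` is the number of crossings until it closes up for the first time. -/
structure ClosedTrajectory (v : ℂ) where
  label : ℤ → ZMod 5
  point : ℤ → ℂ
  period : ℕ
  point_mem : ∀ i, point i ∈ side (label i)
  label_ne : ∀ i, label (i + 1) ≠ label i
  step_even : ∀ i, Even i → ∃ τ : ℝ, 0 < τ ∧ point (i + 1) - point i = (τ : ℂ) * v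
  step_odd : ∀ i, Odd i → ∃ τ : ℝ, 0 < τ ∧
    glue (label (i + 1)) (point (i + 1)) - glue (label i) (point i) = (τ : ℂ) * v
  period_pos : 0 < period
  period_even : Even period
  label_period : ∀ i, label (i + period) = label i
  point_period : ∀ i, point (i + period) = point i
  first_return : ∀ m : ℕ, 0 < m → m < period → point m ≠ point 0

/-- The labels of the sides crossed by a closed trajectory that is traversed once. -/
def ClosedTrajectory.word {v : ℂ} (γ : ClosedTrajectory v) : List (ZMod 5) :=
  (List.range γ.period).map fun i => γ.label (i : ℤ)

/-- `w` is a symbolic orbit, up to a cyclic permutation, for the direction of the line spanned by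
`v`; opposite directions are not distinguished. -/
def IsSymbolicOrbit (v : ℂ) (w : List (ZMod 5)) : Prop :=
  ∃ u : ℂ, (u = v ∨ u = -v) ∧ ∃ γ : ClosedTrajectory u, w ~r γ.word

/-- A short symbolic orbit: one with the smallest period for the given direction. -/
def IsShortOrbit (v : ℂ) (w : List (ZMod 5)) : Prop :=
  IsSymbolicOrbit v w ∧ ∀ w', IsSymbolicOrbit v w' → w.length ≤ w'.length

/-- A long symbolic orbit: one with the largest period for the given direction. -/
def IsLongOrbit (v : ℂ) (w : List (ZMod 5)) : Prop :=
  IsSymbolicOrbit v w ∧ ∀ w', IsSymbolicOrbit v w' → w'.length ≤ w.length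

/-! ## Operations on cyclic words -/

/-- The reduction of a cyclic word: keep only the sandwiched symbols, that is, those whose cyclic
predecessor (`w` rotated by `w.length - 1`) and cyclic successor (`w` rotated by `1`) are equal. -/
def reduce (w : List (ZMod 5)) : List (ZMod 5) :=
  ((w.zip ((w.rotate (w.length - 1)).zip (w.rotate 1))).filter
    fun t => decide (t.2.1 = t.2.2)).map Prod.fst

/-- The cyclic shift of the symbols by `j`. -/
def shift (j : ℕ) (w : List (ZMod 5)) : List (ZMod 5) :=
  w.map fun s => s + (j : ZMod 5)

/-! ## Ideal pentagons and the directions `α`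

A point of the absolute, that is, of the real projective line of directions, is given by a nonzero
direction vector. -/

/-- The determinant of two plane vectors. -/
def det (z w : ℂ) : ℝ := z.re * w.im - z.im * w.re

/-- The reflection of the hyperbolic plane in the geodesic with the ends `a`, `b`, acting on the
absolute: the projective involution of the line of directions that fixes exactly `a` and `b`
(up to the scalar factor `det a b`, the linear map with `a ↦ a`, `b ↦ -b`). -/
def reflect (a b x : ℂ) : ℂ := (det x b : ℂ) * a + (det x a : ℂ) * b

/-- The ideal pentagon of generation `0`: its vertices are the directions of the sides (equivalently,
diagonals) of the regular pentagon, listed in the cyclic order of the sides `1, 5, 4, 3, 2`.  In the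
affine coordinate in which these directions are
`1 - φ / 2, φ / 2 - 1, -φ / 2, ∞, φ / 2`, sector `3` is the arc through `0` between the first two. -/
def pentagonZero (j : ZMod 5) : ℂ := Complex.I * outer (1 - j)

/-- The pentagon of the next generation on the other side of the edge `(p n, p (n + 1))` of the
pentagon `p`: the mirror image of `p` in this edge, with its vertices `0, 1, 2, 3, 4` listed from
`p n` to `p (n + 1)`. -/
def nextPentagon (p : ZMod 5 → ℂ) (n : ZMod 5) (j : ZMod 5) : ℂ :=
  reflect (p n) (p (n + 1)) (p (n - j))

/-- The pentagon of generation `k + 1` bounded by the arc with the indices `n 1, …, n k` (for `k = 0`,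
by the whole arc of sector `3`); its vertices, in order along the arc, are
`α_{n_1 … n_k 0} = α_{n_1 … n_k}, α_{n_1 … n_k 1}, α_{n_1 … n_k 2}, α_{n_1 … n_k 3}`, and the other
end of the arc. -/
def pentagon (n : ℕ → ℕ) : ℕ → ZMod 5 → ℂ
  | 0 => nextPentagon pentagonZero 0
  | k + 1 => nextPentagon (pentagon n k) (n (k + 1) : ZMod 5)

/-- The direction `α_{n_1 … n_k}`, up to a scalar factor: the first vertex on the arc with these
indices; for `k ≥ 1` this is the vertex number `n_k` of the pentagon bounded by the arc with the
indices `n 1, …, n (k - 1)`.  Only the values `n 1, …, n k` are used. -/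
def α (k : ℕ) (n : ℕ → ℕ) : ℂ := pentagon n k 0

end

end DoublePentagon

namespace DoublePentagon

noncomputable section

/-! ## The regular pentagon -/

/-! Record a crossing by its side and its transversal coordinate relative to the midpoint of the
side. A closed trajectory becomes a cycle of crossings. For a direction in the arc between the
directions of the sides 1 and 5, consecutive sides are neighbours on the path 1–4–3–2–5
(`step_cases`). So a symbolic orbit is a closed walk on a path, and its sandwiched symbols are the
places where the walk turns back.

Now reflect the direction in the geodesic joining these two ends. The walk turns at a crossing
exactly if its coordinate is smaller than the half width of the side seen in the reflected direction
(`sandwiched_iff_isTurn`). After negating coordinates, a rising run between two turns is a single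
chord of `P` in the reflected direction, and a falling run is a chord of `-P`. Keeping only the
turns, and conversely filling in the runs, therefore matches the orbits of the two directions
(`exists_cycle_of_turns`, `exists_cycle_of_fill`). All this is linear arithmetic, because the widths
and offsets are linear in the coordinates `p`, `q` of the direction and in their multiples `P`, `Q`
by the golden ratio `φ = 2 * inr`.

The reflection interchanges the pentagons of the generations 0 and 1 and reverses the order of
vertices, so edge `n` becomes edge `3 - n` and vertex `n` becomes vertex `4 - n`. A rotation taking
the edge numbered `n 1` back to the initial one adds `n 1 + 1` to the labels, and the final shift
undoes it (`α_proportional`).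

It remains to see that there are exactly two orbits and that short goes to short. The bare
inequality of lengths is not a suitable induction hypothesis: the two orbits `5 2` and `3 4` in the
direction of side 1, where the induction starts, have equal length. Instead one carries the relation
that the signed symbol counts of the long orbit are `φ` times those of the short one, where `φ` acts
by `-(outer (s + 1) + outer (s - 1)) = φ * outer s`. Filling preserves this linear relation, and
after one filling it forces the strict inequality (`isPair_dir`, `exists_isPair_α`). -/

/-- The inner radius of the pentagon `P`. -/
def inr : ℝ := Real.cos (Real.pi / 5)

/-- Half of the length of a side of `P`. -/
def half : ℝ := Real.sin (Real.pi / 5)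

lemma four_inr_sq : 4 * inr ^ 2 = 2 * inr + 1 := by
  have h := Real.quadratic_root_cos_pi_div_five
  unfold inr
  linarith

lemma inr_sq_add_half_sq : inr ^ 2 + half ^ 2 = 1 := Real.cos_sq_add_sin_sq _

lemma half_pos : 0 < half :=
  Real.sin_pos_of_pos_of_lt_pi (by positivity) (by linarith [Real.pi_pos])

lemma inr_gt : 4 / 5 < inr := by
  have h : 0 < inr := Real.cos_pos_of_mem_Ioo ⟨by linarith [Real.pi_pos], by linarith [Real.pi_pos]⟩
  nlinarith [four_inr_sq]

/-- The scalar product of two plane vectors. -/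
def ip (z w : ℂ) : ℝ := z.re * w.re + z.im * w.im

lemma outer_zero : outer 0 = 1 := by simp [outer]

lemma outer_one : outer 1 = (-inr : ℝ) + (-half : ℝ) * Complex.I := by
  have h : (6 * Real.pi / 5 * ((1 : ZMod 5).val : ℝ) : ℝ) = Real.pi / 5 + Real.pi := by
    rw [show (1 : ZMod 5).val = 1 from rfl]
    push_cast
    ring
  rw [outer, h, Complex.exp_mul_I, ← Complex.ofReal_cos, ← Complex.ofReal_sin, Real.cos_add_pi,
    Real.sin_add_pi, inr, half]

lemma outer_eq_pow (s : ZMod 5) : outer s = outer 1 ^ s.val := by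
  rw [outer, outer, ← Complex.exp_nat_mul]
  congr 1
  rw [show (1 : ZMod 5).val = 1 from rfl]
  push_cast
  ring

lemma outer_one_pow_five : outer 1 ^ 5 = 1 := by
  rw [outer, ← Complex.exp_nat_mul, Complex.exp_eq_one_iff]
  refine ⟨3, ?_⟩
  rw [show (1 : ZMod 5).val = 1 from rfl]
  push_cast
  ring

lemma outer_add (s t : ZMod 5) : outer (s + t) = outer s * outer t := by
  rw [outer_eq_pow s, outer_eq_pow t, outer_eq_pow (s + t), ← pow_add, ZMod.val_add,
    ← pow_mod_orderOf, ← pow_mod_orderOf _ (s.val + t.val)]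
  rw [Nat.mod_mod_of_dvd _ (orderOf_dvd_of_pow_eq_one outer_one_pow_five)]

lemma outer_re_sq_add_im_sq (s : ZMod 5) : (outer s).re ^ 2 + (outer s).im ^ 2 = 1 := by
  have h : ‖outer s‖ = 1 := by rw [outer, Complex.norm_exp_ofReal_mul_I]
  have h2 := Complex.sq_norm (outer s)
  rw [h, Complex.normSq_apply] at h2
  linarith

lemma outer_two : outer 2 = (inr - 1 / 2 : ℝ) + (2 * inr * half : ℝ) * Complex.I := by
  rw [show (2 : ZMod 5) = 1 + 1 by decide, outer_add, outer_one]
  have h := four_inr_sq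
  have h' := inr_sq_add_half_sq
  apply Complex.ext <;> simp <;> linarith

lemma outer_four : outer 4 = (-inr : ℝ) + (half : ℝ) * Complex.I := by
  rw [show (4 : ZMod 5) = 2 + 2 by decide, outer_add, outer_two]
  have h := four_inr_sq
  have h' := inr_sq_add_half_sq
  apply Complex.ext <;> simp
  · linear_combination (-4 * inr ^ 2) * h' + (inr ^ 2 + 1 / 2 * inr - 1 / 4) * h
  · linear_combination (half) * h

lemma outer_three : outer 3 = (inr - 1 / 2 : ℝ) + (-(2 * inr * half) : ℝ) * Complex.I := by
  rw [show (3 : ZMod 5) = 4 + 4 by decide, outer_add, outer_four]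
  have h := four_inr_sq
  have h' := inr_sq_add_half_sq
  apply Complex.ext <;> simp <;> linarith

/-- The point of the line through the side `s` of `P` at the oriented distance `t` from its
midpoint. -/
def sidePoint (s : ZMod 5) (t : ℝ) : ℂ := outer s * ((inr : ℂ) + (t : ℂ) * Complex.I)

lemma mem_side_iff {s : ZMod 5} {z : ℂ} : z ∈ side s ↔ ∃ t, |t| < half ∧ z = sidePoint s t := by
  have e1 : outer s * Complex.exp (((-(Real.pi / 5) : ℝ) : ℂ) * Complex.I)
      = outer s * ((inr : ℂ) - (half : ℂ) * Complex.I) := by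
    rw [Complex.exp_mul_I, ← Complex.ofReal_cos, ← Complex.ofReal_sin, Real.cos_neg, Real.sin_neg,
      inr, half]
    push_cast
    ring
  have e2 : outer s * Complex.exp (((Real.pi / 5 : ℝ) : ℂ) * Complex.I)
      = outer s * ((inr : ℂ) + (half : ℂ) * Complex.I) := by
    rw [Complex.exp_mul_I, ← Complex.ofReal_cos, ← Complex.ofReal_sin, inr, half]
  have hp := half_pos
  rw [side, e1, e2, openSegment]
  constructor
  · rintro ⟨a, b, ha, hb, hab, rfl⟩
    refine ⟨(b - a) * half, ?_, ?_⟩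
    · rw [abs_lt]
      constructor <;> nlinarith
    · have : (a : ℂ) + b = 1 := by exact_mod_cast hab
      simp only [sidePoint, Complex.real_smul]
      push_cast
      linear_combination outer s * inr * this
  · rintro ⟨t, ht, rfl⟩
    rw [abs_lt] at ht
    have hne : (half : ℂ) ≠ 0 := by exact_mod_cast hp.ne'
    refine ⟨(half - t) / (2 * half), (half + t) / (2 * half), div_pos (by linarith) (by linarith),
      div_pos (by linarith) (by linarith), by field_simp; ring, ?_⟩
    simp only [sidePoint, Complex.real_smul]
    push_cast
    field_simp
    ring

lemma ip_sidePoint_self (s : ZMod 5) (t : ℝ) : ip (sidePoint s t) (outer s) = inr := by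
  have h := outer_re_sq_add_im_sq s
  simp only [ip, sidePoint, Complex.mul_re, Complex.mul_im, Complex.add_re, Complex.add_im,
    Complex.ofReal_re, Complex.ofReal_im, Complex.I_re, Complex.I_im]
  linear_combination inr * h

/-- Convexity of `P`. After a rotation the claim is affine in `t`, and equality could occur only at
a vertex shared by adjacent sides. -/
lemma ip_sidePoint_lt {s s' : ZMod 5} (hs : s ≠ s') {t : ℝ} (ht : |t| < half) :
    ip (sidePoint s t) (outer s') < inr := by
  have h1 := outer_re_sq_add_im_sq s'
  obtain ⟨k, rfl⟩ : ∃ k, s = s' + k := ⟨s - s', by ring⟩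
  have hk : k ≠ 0 := by
    rintro rfl
    simp at hs
  have e : ip (sidePoint (s' + k) t) (outer s') = (outer k).re * inr - (outer k).im * t := by
    rw [sidePoint, outer_add]
    simp only [ip, Complex.mul_re, Complex.mul_im, Complex.add_re, Complex.add_im,
      Complex.ofReal_re, Complex.ofReal_im, Complex.I_re, Complex.I_im]
    linear_combination ((outer k).re * inr - (outer k).im * t) * h1
  rw [e]
  have h := four_inr_sq
  have h' := inr_sq_add_half_sq
  have hp := half_pos
  have hg := inr_gt
  rw [abs_lt] at ht
  have ht1 : 0 < half * (half - t) := mul_pos hp (by linarith)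
  have ht2 : 0 < half * (half + t) := mul_pos hp (by linarith)
  have ht3 : 0 < inr * (half * (half - t)) := mul_pos (by linarith) ht1
  have ht4 : 0 < inr * (half * (half + t)) := mul_pos (by linarith) ht2
  have h3 : inr * half ^ 2 = inr - inr * inr ^ 2 := by linear_combination inr * h'
  have h4 : 4 * (inr * inr ^ 2) = 2 * inr ^ 2 + inr := by linear_combination inr * h
  fin_cases k
  · exact absurd rfl hk
  · change (outer 1).re * inr - (outer 1).im * t < inr
    rw [outer_one]
    simp
    nlinarith
  · change (outer 2).re * inr - (outer 2).im * t < inr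
    rw [outer_two]
    simp
    nlinarith
  · change (outer 3).re * inr - (outer 3).im * t < inr
    rw [outer_three]
    simp
    nlinarith
  · change (outer 4).re * inr - (outer 4).im * t < inr
    rw [outer_four]
    simp
    nlinarith

lemma det_sidePoint (v : ℂ) (s : ZMod 5) (t : ℝ) :
    det v (sidePoint s t) = inr * det v (outer s) + t * ip v (outer s) := by
  simp only [ip, det, sidePoint, Complex.mul_re, Complex.mul_im, Complex.add_re, Complex.add_im,
    Complex.ofReal_re, Complex.ofReal_im, Complex.I_re, Complex.I_im]
  ring

/-- A chord of `P` in the direction `v` joins the sides `s` and `s'` exactly if it enters through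
`s`, leaves through `s'` and its ends have the same transversal coordinate. -/
lemma exists_chord_iff {v : ℂ} {s s' : ZMod 5} {t t' : ℝ} (ht : |t| < half) (ht' : |t'| < half)
    (hs : s ≠ s') :
    (∃ τ : ℝ, 0 < τ ∧ sidePoint s' t' - sidePoint s t = (τ : ℂ) * v) ↔
      ip v (outer s) < 0 ∧ 0 < ip v (outer s') ∧
        det v (sidePoint s' t') = det v (sidePoint s t) := by
  have h1 := ip_sidePoint_self s t
  have h2 := ip_sidePoint_self s' t'
  have h3 := ip_sidePoint_lt hs ht
  have h4 := ip_sidePoint_lt hs.symm ht'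
  generalize sidePoint s t = z at *
  generalize sidePoint s' t' = z' at *
  generalize outer s = o at *
  generalize outer s' = o' at *
  constructor
  · rintro ⟨τ, hτ, h⟩
    obtain rfl : z' = z + τ * v := by linear_combination h
    simp only [ip, det, Complex.add_re, Complex.add_im, Complex.mul_re, Complex.mul_im,
      Complex.ofReal_re, Complex.ofReal_im] at *
    refine ⟨?_, ?_, by ring⟩
    · by_contra hc
      nlinarith
    · by_contra hc
      nlinarith
  · rintro ⟨h5, h6, h7⟩
    have h8 : ip (z' - z) o < 0 := by
      simp only [ip, Complex.sub_re, Complex.sub_im] at *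
      linarith
    -- The time is the ratio of the components of the displacement and of `v` normal to the entry
    -- side.
    refine ⟨ip (z' - z) o / ip v o, div_pos_of_neg_of_neg h8 h5, ?_⟩
    have h9 : (ip v o : ℂ) ≠ 0 := by exact_mod_cast h5.ne
    push_cast
    rw [div_mul_eq_mul_div, eq_div_iff h9]
    simp only [ip, det] at h7 ⊢
    apply Complex.ext <;> simp
    · linear_combination (-o.im) * h7
    · linear_combination (o.re) * h7

/-- Seen in `-P`, a crossing point is the centrally symmetric image of a point of `P` with the
opposite side coordinate. Hence motion in `-P` along `v` is motion in `P` along `-v`. -/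
lemma glue_sidePoint (s : ZMod 5) (t : ℝ) : glue s (sidePoint s t) = -sidePoint s (-t) := by
  rw [glue, ← inr]
  simp only [sidePoint]
  push_cast
  ring

/-! ## The crossing map -/

/-- A crossing of a trajectory with a side: the label of the side, and the transversal coordinate
relative to the midpoint of this side. -/
abbrev Crossing := ZMod 5 × ℝ

/-- The half width of the side `s` seen in the direction `v`; it is positive if a trajectory leaves
`P` through `s`, and negative if it enters `P` there. -/
def width (v : ℂ) (s : ZMod 5) : ℝ := half * ip v (outer s)

/-- The transversal coordinate of the midpoint of the side `s` of `P`. -/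
def offset (v : ℂ) (s : ZMod 5) : ℝ := inr * det v (outer s)

/-- Consecutive crossings of a trajectory, for sides with the signed half widths `A` and the offsets
`B`: the trajectory runs through `P` if `A` is negative at the first side, otherwise
through `-P`. -/
def Step (A B : ZMod 5 → ℝ) (a b : Crossing) : Prop :=
  |a.2| < |A a.1| ∧ |b.2| < |A b.1| ∧
    (A a.1 < 0 ∧ 0 < A b.1 ∧ b.2 + B b.1 = a.2 + B a.1 ∨
      0 < A a.1 ∧ A b.1 < 0 ∧ b.2 - B b.1 = a.2 - B a.1)

lemma ip_neg (v w : ℂ) : ip (-v) w = -ip v w := by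
  simp [ip]
  ring

lemma width_neg (v : ℂ) : width (-v) = fun s => -width v s := by
  funext s
  simp [width, ip_neg]

lemma offset_neg (v : ℂ) : offset (-v) = fun s => -offset v s := by
  funext s
  simp [offset, det]
  ring

/-- The central symmetry interchanging `P` and `-P` reverses both `v` and the side coordinate, so
the transversal coordinate survives. Statements about `-P` reduce to those about `P` in this way. -/
lemma step_neg (A B : ZMod 5 → ℝ) : Step (fun s => -A s) (fun s => -B s) = Step A B := by
  funext a b
  simp only [Step, abs_neg, eq_iff_iff, neg_lt_zero, Left.neg_pos_iff, sub_neg_eq_add,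
    ← sub_eq_add_neg]
  tauto

lemma step_of_chord {v : ℂ} {s s' : ZMod 5} {t t' : ℝ} (ht : |t| < half) (ht' : |t'| < half)
    (hs : s ≠ s')
    (h : ∃ τ : ℝ, 0 < τ ∧ sidePoint s' t' - sidePoint s t = (τ : ℂ) * v) :
    Step (width v) (offset v) (s, t * ip v (outer s)) (s', t' * ip v (outer s')) := by
  obtain ⟨h1, h2, h3⟩ := (exists_chord_iff ht ht' hs).1 h
  rw [det_sidePoint, det_sidePoint] at h3
  have hp := half_pos
  refine ⟨?_, ?_, Or.inl ⟨mul_neg_of_pos_of_neg hp h1, mul_pos hp h2, ?_⟩⟩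
  · simp only [width, abs_mul]
    exact mul_lt_mul_of_pos_right (by rwa [abs_of_pos hp]) (abs_pos.2 h1.ne)
  · simp only [width, abs_mul]
    exact mul_lt_mul_of_pos_right (by rwa [abs_of_pos hp]) (abs_pos.2 h2.ne')
  · simp only [offset]
    linarith

lemma abs_div_ip_lt {v : ℂ} {a : Crossing} (h : |a.2| < |width v a.1|) :
    |a.2 / ip v (outer a.1)| < half := by
  rw [width, abs_mul, abs_of_pos half_pos] at h
  have : 0 < |ip v (outer a.1)| := by
    by_contra hc
    nlinarith [abs_nonneg a.2, half_pos]
  rwa [abs_div, div_lt_iff₀ this]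

lemma chord_of_step {v : ℂ} {a b : Crossing} (h : Step (width v) (offset v) a b)
    (ha : width v a.1 < 0) :
    ∃ τ : ℝ, 0 < τ ∧ sidePoint b.1 (b.2 / ip v (outer b.1)) - sidePoint a.1 (a.2 / ip v (outer a.1))
      = (τ : ℂ) * v := by
  have hp := half_pos
  obtain ⟨h1, h2, ⟨h3, h4, h5⟩ | ⟨h3, -⟩⟩ := h
  · have h6 : ip v (outer a.1) < 0 := by
      unfold width at h3
      by_contra hc
      nlinarith
    have h7 : 0 < ip v (outer b.1) := by
      unfold width at h4
      by_contra hc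
      nlinarith
    have hs : a.1 ≠ b.1 := fun e => by
      rw [e] at h6
      linarith
    rw [exists_chord_iff (abs_div_ip_lt h1) (abs_div_ip_lt h2) hs]
    refine ⟨h6, h7, ?_⟩
    rw [det_sidePoint, det_sidePoint, div_mul_cancel₀ _ h6.ne, div_mul_cancel₀ _ h7.ne']
    simp only [offset] at h5
    linarith
  · linarith

/-- Two different entry points for the same exit point would lie on one line; the segment between
them would be a chord leaving `P` through a side where the trajectory enters. -/
lemma step_left_unique_of_neg {v : ℂ} {a b c : Crossing} (ha : width v a.1 < 0)
    (h1 : Step (width v) (offset v) a c) (h2 : Step (width v) (offset v) b c) : a = b := by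
  have hp := half_pos
  have hc : 0 < width v c.1 ∧ c.2 + offset v c.1 = a.2 + offset v a.1 := by
    obtain ⟨-, -, ⟨-, h⟩ | ⟨h, -⟩⟩ := h1
    · exact h
    · linarith
  have hb : width v b.1 < 0 ∧ c.2 + offset v c.1 = b.2 + offset v b.1 := by
    obtain ⟨-, -, ⟨h, -, h'⟩ | ⟨-, h, -⟩⟩ := h2
    · exact ⟨h, h'⟩
    · linarith
  have hlab : a.1 = b.1 := by
    by_contra hne
    obtain ⟨τ, -, e1⟩ := chord_of_step h1 ha
    obtain ⟨τ', -, e2⟩ := chord_of_step h2 hb.1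
    have ta := abs_div_ip_lt h1.1
    have tb := abs_div_ip_lt h2.1
    rcases lt_trichotomy τ τ' with h | h | h
    · have := (exists_chord_iff (v := v) tb ta (Ne.symm hne)).1 ⟨τ' - τ, by linarith, by
        push_cast
        linear_combination e2 - e1⟩
      have := mul_pos hp this.2.1
      exact absurd ha (not_lt.2 this.le)
    · subst h
      have h3 := ip_sidePoint_lt hne ta
      have h4 := ip_sidePoint_self b.1 (b.2 / ip v (outer b.1))
      have h5 : sidePoint a.1 (a.2 / ip v (outer a.1)) =
          sidePoint b.1 (b.2 / ip v (outer b.1)) := by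
        linear_combination e2 - e1
      rw [h5, h4] at h3
      exact lt_irrefl _ h3
    · have := (exists_chord_iff (v := v) ta tb hne).1 ⟨τ - τ', by linarith, by
        push_cast
        linear_combination e1 - e2⟩
      have := mul_pos hp this.2.1
      exact absurd hb.1 (not_lt.2 this.le)
  refine Prod.ext hlab ?_
  have := hc.2.symm.trans hb.2
  rw [hlab] at this
  linarith

lemma step_left_unique {v : ℂ} {a b c : Crossing}
    (h1 : Step (width v) (offset v) a c) (h2 : Step (width v) (offset v) b c) : a = b := by
  by_cases ha : width v a.1 < 0
  · exact step_left_unique_of_neg ha h1 h2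
  · have ha' : width (-v) a.1 < 0 := by
      rw [width_neg]
      obtain ⟨-, -, ⟨h, -⟩ | ⟨h, -⟩⟩ := h1
      · exact absurd h ha
      · linarith
    rw [← step_neg, ← width_neg, ← offset_neg] at h1 h2
    exact step_left_unique_of_neg ha' h1 h2

/-! ## Cycles of crossings -/

/-- A cyclic sequence of distinct consecutive crossings. -/
structure IsOrbitCycle (A B : ZMod 5 → ℝ) (l : List Crossing) : Prop where
  ne_nil : l ≠ []
  nodup : l.Nodup
  chain : Cycle.Chain (Step A B) (l : Cycle Crossing)

lemma IsOrbitCycle.isRotated {A B : ZMod 5 → ℝ} {l l' : List Crossing} (h : IsOrbitCycle A B l)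
    (hr : l ~r l') : IsOrbitCycle A B l' where
  ne_nil := by
    rintro rfl
    exact h.ne_nil (List.isRotated_nil_iff.1 hr)
  nodup := hr.nodup_iff.1 h.nodup
  chain := by
    rw [← Cycle.coe_eq_coe.2 hr]
    exact h.chain

/-- Since predecessors are unique, any repetition can be pulled back step by step until it involves
the first element. -/
lemma nodup_of_isChain {β : Type*} {r : β → β → Prop} (hr : ∀ a b c, r a c → r b c → a = b)
    {a : β} {l : List β} (h : List.IsChain r (a :: l)) (ha : a ∉ l) : (a :: l).Nodup := by
  rw [List.isChain_iff_getElem] at h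
  rw [List.nodup_iff_pairwise_ne, List.pairwise_iff_getElem]
  intro i
  induction i with
  | zero =>
    intro j hi hj hij e
    obtain ⟨j, rfl⟩ := Nat.exists_eq_add_one.2 hij
    simp only [List.getElem_cons_zero, List.getElem_cons_succ] at e
    exact ha (e ▸ List.getElem_mem _)
  | succ i ih =>
    intro j hi hj hij e
    obtain ⟨j, rfl⟩ := Nat.exists_eq_add_one.2 (Nat.zero_lt_of_lt hij)
    have h1 := h i hi
    have h2 := h j hj
    rw [e] at h1
    exact ih j (by omega) (by omega) (by omega) (hr _ _ _ h1 h2)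

lemma cycle_chain_iff_getElem {β : Type*} {r : β → β → Prop} {l : List β} (hl : l ≠ []) :
    Cycle.Chain r (l : Cycle β) ↔
      ∀ (i : ℕ) (hi : i < l.length), r l[i] (l[(i + 1) % l.length]'(Nat.mod_lt _ (by omega))) := by
  obtain ⟨a, l, rfl⟩ := List.exists_cons_of_ne_nil hl
  rw [Cycle.chain_coe_cons, List.isChain_iff_getElem]
  simp only [List.length_cons, List.length_append, List.length_nil]
  have key : ∀ i (hi : i < l.length + 1), (a :: (l ++ [a]))[i + 1]'(by simp; omega) =
      (a :: l)[(i + 1) % (l.length + 1)]'(Nat.mod_lt _ (by omega)) := by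
    intro i hi
    rcases Nat.lt_or_ge i l.length with h | h
    · simp [Nat.mod_eq_of_lt (show i + 1 < l.length + 1 by omega), List.getElem_append_left, h]
    · obtain rfl : i = l.length := by omega
      simp
  have key' : ∀ i (hi : i < l.length + 1), (a :: (l ++ [a]))[i]'(by simp; omega) = (a :: l)[i] := by
    intro i hi
    have : a :: (l ++ [a]) = (a :: l) ++ [a] := rfl
    simp only [this]
    rw [List.getElem_append_left]
  constructor
  · intro h i hi
    have := h i (by omega)
    rwa [key i hi, key' i hi] at this
  · intro h i hi
    rw [key i (by omega), key' i (by omega)]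
    exact h i (by omega)

/-- The cyclic words of the cycles of crossings in the direction `v`. -/
def IsOrbit (v : ℂ) (w : List (ZMod 5)) : Prop :=
  ∃ l, IsOrbitCycle (width v) (offset v) l ∧ w ~r l.map Prod.fst

lemma IsOrbit.isRotated {v : ℂ} {w w' : List (ZMod 5)} (h : IsOrbit v w) (hr : w' ~r w) :
    IsOrbit v w' := by
  obtain ⟨l, hl, hw⟩ := h
  exact ⟨l, hl, hr.trans hw⟩

lemma isOrbit_neg (v : ℂ) : IsOrbit (-v) = IsOrbit v := by
  funext w
  have h : Step (width (-v)) (offset (-v)) = Step (width v) (offset v) := by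
    rw [width_neg, offset_neg, step_neg]
  refine propext ⟨?_, ?_⟩
  · rintro ⟨l, ⟨h1, h2, h3⟩, hw⟩
    exact ⟨l, ⟨h1, h2, h ▸ h3⟩, hw⟩
  · rintro ⟨l, ⟨h1, h2, h3⟩, hw⟩
    exact ⟨l, ⟨h1, h2, h ▸ h3⟩, hw⟩

/-! ### Closed trajectories versus cycles of crossings -/

lemma ClosedTrajectory.word_eq {v : ℂ} (γ : ClosedTrajectory v) :
    γ.word = (List.range γ.period).map fun i : ℕ => γ.label i := by
  simp only [ClosedTrajectory.word, List.pure_def, List.bind_eq_flatMap, List.map_flatMap,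
    List.map_cons, List.map_nil]
  exact List.flatMap_pure_eq_map _ _

lemma isOrbit_word {v : ℂ} (γ : ClosedTrajectory v) : IsOrbit v γ.word := by
  choose t ht hpt using fun i => mem_side_iff.1 (γ.point_mem i)
  let a : ℤ → Crossing := fun i => (γ.label i, t i * ip v (outer (γ.label i)))
  have hstep : ∀ i, Step (width v) (offset v) (a i) (a (i + 1)) := by
    intro i
    rcases Int.even_or_odd i with hi | hi
    · obtain ⟨τ, hτ, h⟩ := γ.step_even i hi
      rw [hpt, hpt] at h
      exact step_of_chord (ht i) (ht (i + 1)) (γ.label_ne i).symm ⟨τ, hτ, h⟩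
    · obtain ⟨τ, hτ, h⟩ := γ.step_odd i hi
      rw [hpt, hpt, glue_sidePoint, glue_sidePoint] at h
      -- A passage through `-P` is treated as one through `P` in the direction `-v`, with opposite
      -- side coordinates.
      have := step_of_chord (v := -v) (t := -t i) (t' := -t (i + 1)) (by rw [abs_neg]; exact ht i)
        (by rw [abs_neg]; exact ht (i + 1)) (γ.label_ne i).symm
        ⟨τ, hτ, by linear_combination -h⟩
      rw [width_neg, offset_neg, step_neg, ip_neg, ip_neg, neg_mul_neg, neg_mul_neg] at this
      exact this
  have hper : ∀ i, a (i + γ.period) = a i := by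
    intro i
    have h1 := γ.label_period i
    have h2 : t (i + γ.period) = t i := by
      have h2 := γ.point_period i
      rw [hpt, hpt, h1] at h2
      have h3 : outer (γ.label i) ≠ 0 := fun h => by
        have := outer_re_sq_add_im_sq (γ.label i)
        rw [h] at this
        simp at this
      have h4 := mul_left_cancel₀ h3 h2
      have h5 := congrArg Complex.im h4
      simpa using h5
    simp only [a]
    rw [h1, h2]
  -- The definition of the period only excludes a return to the initial point; distinctness of all
  -- crossings then follows from the uniqueness of predecessors.
  have hret : ∀ m : ℕ, 0 < m → m < γ.period → a m ≠ a 0 := by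
    intro m h0 hm h
    have h1 := congrArg Prod.fst h
    have h2 := congrArg Prod.snd h
    simp only [a] at h1 h2
    refine γ.first_return m h0 hm ?_
    have h3 : ip v (outer (γ.label 0)) ≠ 0 := by
      intro h3
      have := (hstep 0).1
      simp only [a, width, h3] at this
      simp at this
    rw [hpt, hpt, h1]
    rw [h1] at h2
    rw [mul_right_cancel₀ h3 h2]
  obtain ⟨n, hn⟩ := Nat.exists_eq_add_one.2 γ.period_pos
  refine ⟨(List.range γ.period).map fun i : ℕ => a i, ⟨?_, ?_, ?_⟩, ?_⟩
  · simp [hn]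
  · have e : (List.range γ.period).map (fun i : ℕ => a i) =
        a (0 : ℕ) :: (List.range n).map fun i : ℕ => a (i + 1 : ℕ) := by
      rw [hn, List.range_succ_eq_map, List.map_cons, List.map_map]
      rfl
    rw [e]
    refine nodup_of_isChain (r := Step (width v) (offset v)) (fun _ _ _ => step_left_unique) ?_ ?_
    · rw [← e, List.isChain_iff_getElem]
      intro i hi
      simp only [List.getElem_map, List.getElem_range]
      exact_mod_cast hstep i
    · intro hmem
      simp only [List.mem_map, List.mem_range] at hmem
      obtain ⟨m, hm, e'⟩ := hmem
      exact hret (m + 1) (by omega) (by omega) (by exact_mod_cast e')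
  · rw [← Cycle.map_coe, Cycle.chain_map, hn, Cycle.chain_range_succ]
    constructor
    · have h1 := hstep n
      have h2 := hper 0
      rw [hn] at h2
      push_cast at h2
      rw [zero_add] at h2
      rw [h2] at h1
      exact_mod_cast h1
    · intro m _
      exact_mod_cast hstep m
  · rw [List.map_map, γ.word_eq]
    exact List.IsRotated.refl _

/-- The closed trajectory through a cycle of crossings. -/
lemma exists_closedTrajectory {v : ℂ} {l : List Crossing}
    (hl : IsOrbitCycle (width v) (offset v) l) (hneg : ∀ h, width v (l[0]'h).1 < 0) :
    ∃ γ : ClosedTrajectory v, γ.word = l.map Prod.fst := by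
  have hpos : 0 < l.length := List.length_pos_of_ne_nil hl.ne_nil
  have hchain := (cycle_chain_iff_getElem hl.ne_nil).1 hl.chain
  have hlt : ∀ i : ℤ, (i % l.length).toNat < l.length := by
    intro i
    have h1 := Int.emod_nonneg i (b := l.length) (by omega)
    have h2 := Int.emod_lt_of_pos i (b := l.length) (by omega)
    omega
  let f : ℤ → Crossing := fun i => l[(i % l.length).toNat]'(hlt i)
  have hper : ∀ i, f (i + l.length) = f i := by
    intro i
    simp only [f, Int.add_emod_right]
  have hnat : ∀ (i : ℕ) (hi : i < l.length), f i = l[i] := by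
    intro i hi
    have : ((i : ℤ) % l.length).toNat = i := by
      rw [← Int.natCast_mod, Int.toNat_natCast, Nat.mod_eq_of_lt hi]
    simp only [f, this]
  have hstep : ∀ i, Step (width v) (offset v) (f i) (f (i + 1)) := by
    intro i
    have h := hchain _ (hlt i)
    have h1 := Int.emod_nonneg i (b := l.length) (by omega)
    have e : ((i % l.length).toNat + 1) % l.length = ((i + 1) % l.length).toNat := by
      zify
      rw [Int.toNat_of_nonneg h1, Int.toNat_of_nonneg (Int.emod_nonneg _ (by omega)),
        Int.emod_add_emod]
    simp only [f]
    simp only [e] at h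
    exact h
  have hsgn : ∀ i, (width v (f i).1 < 0 ↔ ¬ width v (f (i + 1)).1 < 0) := by
    intro i
    obtain ⟨-, -, ⟨h1, h2, -⟩ | ⟨h1, h2, -⟩⟩ := hstep i
    · simp [h1, h2.le]
    · simp [h1.le, h2]
  -- The sign of the width alternates along the cycle, so it records the parity of the index; here
  -- the assumption that crossing `0` enters `P` is needed.
  have hpar : ∀ i : ℤ, Even i ↔ width v (f i).1 < 0 := by
    intro i
    induction i using Int.induction_on with
    | zero =>
      have := hnat 0 hpos
      simp only [Nat.cast_zero] at this
      simp [this, hneg hpos]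
    | succ i ih => rw [Int.even_add_one, ih, hsgn i, not_not]
    | pred i ih =>
      have h := hsgn (-i - 1)
      rw [sub_add_cancel, ← ih] at h
      rw [h, Int.even_sub_one]
  have hip : ∀ i, ip v (outer (f i).1) ≠ 0 := by
    intro i h
    have := (hstep i).1
    simp only [width, h] at this
    simp only [mul_zero, abs_zero] at this
    exact absurd this (not_lt.2 (abs_nonneg _))
  refine ⟨{
    label := fun i => (f i).1
    point := fun i => sidePoint (f i).1 ((f i).2 / ip v (outer (f i).1))
    period := l.length
    point_mem := fun i => mem_side_iff.2 ⟨_, abs_div_ip_lt (hstep i).1, rfl⟩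
    label_ne := ?_
    step_even := fun i hi => chord_of_step (hstep i) ((hpar i).1 hi)
    step_odd := ?_
    period_pos := hpos
    period_even := ?_
    label_period := fun i => by simp only [hper]
    point_period := fun i => by simp only [hper]
    first_return := ?_ }, ?_⟩
  · intro i h
    have := hsgn i
    rw [h] at this
    tauto
  · intro i hi
    have h1 : width (-v) (f i).1 < 0 := by
      rw [width_neg]
      have := (hpar i).not.1 (Int.not_even_iff_odd.2 hi)
      obtain ⟨-, -, ⟨h, -⟩ | ⟨h, -⟩⟩ := hstep i
      · exact absurd h this
      · linarith
    have h2 := hstep i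
    rw [← step_neg, ← width_neg, ← offset_neg] at h2
    obtain ⟨τ, hτ, h⟩ := chord_of_step h2 h1
    refine ⟨τ, hτ, ?_⟩
    rw [glue_sidePoint, glue_sidePoint]
    rw [ip_neg, ip_neg, div_neg, div_neg] at h
    linear_combination -h
  -- The crossing number `l.length` is crossing `0` again, so parity as read off from the width
  -- makes the period even.
  · have h := (hpar (0 + l.length)).trans ((congrArg (fun a : Crossing => width v a.1 < 0)
      (hper 0)).to_iff.trans (hpar 0).symm)
    rw [zero_add] at h
    exact_mod_cast h.2 (by simp)
  · intro m h0 hm h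
    have hlab : (f m).1 = (f 0).1 := by
      by_contra hne
      have h1 := ip_sidePoint_lt hne (abs_div_ip_lt (hstep m).1)
      rw [h, ip_sidePoint_self] at h1
      exact lt_irrefl _ h1
    have h3 : (f m).2 = (f 0).2 := by
      have h4 := congrArg (det v) h
      rw [det_sidePoint, det_sidePoint, div_mul_cancel₀ _ (hip _), div_mul_cancel₀ _ (hip _),
        hlab] at h4
      linarith
    have h5 : f m = f (0 : ℕ) := Prod.ext hlab h3
    rw [hnat m hm, hnat 0 hpos] at h5
    have := (List.Nodup.getElem_inj_iff hl.nodup).1 h5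
    omega
  · refine List.ext_getElem (by simp [ClosedTrajectory.word_eq]) ?_
    intro i h1 h2
    simp only [List.length_map] at h2
    simp [ClosedTrajectory.word_eq, hnat i h2]

/-- A recorded trajectory starts by entering `P`. A cycle whose first crossing enters `-P` is
therefore realized in the direction `-v`; this is why opposite directions are not distinguished. -/
lemma isSymbolicOrbit_iff (v : ℂ) (w : List (ZMod 5)) : IsSymbolicOrbit v w ↔ IsOrbit v w := by
  constructor
  · rintro ⟨u, rfl | rfl, γ, hw⟩
    · exact (isOrbit_word γ).isRotated hw
    · rw [← isOrbit_neg]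
      exact (isOrbit_word γ).isRotated hw
  · rintro ⟨l, hl, hw⟩
    have hpos : 0 < l.length := List.length_pos_of_ne_nil hl.ne_nil
    have hchain := (cycle_chain_iff_getElem hl.ne_nil).1 hl.chain 0 hpos
    by_cases h : width v (l[0]'hpos).1 < 0
    · obtain ⟨γ, hγ⟩ := exists_closedTrajectory hl fun _ => h
      exact ⟨v, Or.inl rfl, γ, hγ ▸ hw⟩
    · have hl' : IsOrbitCycle (width (-v)) (offset (-v)) l := by
        refine ⟨hl.ne_nil, hl.nodup, ?_⟩
        rw [width_neg, offset_neg, step_neg]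
        exact hl.chain
      obtain ⟨γ, hγ⟩ := exists_closedTrajectory hl' fun _ => by
        rw [width_neg]
        obtain ⟨-, -, ⟨h', -⟩ | ⟨h', -⟩⟩ := hchain
        · exact absurd h' h
        · linarith
      exact ⟨-v, Or.inr rfl, γ, hγ ▸ hw⟩

/-! ## Rotations and homotheties -/

lemma IsOrbitCycle.map {A B A' B' : ZMod 5 → ℝ} {l : List Crossing} {f : Crossing → Crossing}
    (hf : Function.Injective f) (h : ∀ a b, Step A B a b → Step A' B' (f a) (f b))
    (hl : IsOrbitCycle A B l) : IsOrbitCycle A' B' (l.map f) where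
  ne_nil := by simpa using hl.ne_nil
  nodup := hl.nodup.map hf
  chain := by
    rw [← Cycle.map_coe, Cycle.chain_map]
    exact hl.chain.imp h

lemma width_outer_mul (k s : ZMod 5) (v : ℂ) : width (outer k * v) (s + k) = width v s := by
  have h := outer_re_sq_add_im_sq k
  simp only [width, ip, outer_add, Complex.mul_re, Complex.mul_im]
  linear_combination (half * (v.re * (outer s).re + v.im * (outer s).im)) * h

lemma offset_outer_mul (k s : ZMod 5) (v : ℂ) : offset (outer k * v) (s + k) = offset v s := by
  have h := outer_re_sq_add_im_sq k
  simp only [offset, det, outer_add, Complex.mul_re, Complex.mul_im]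
  linear_combination (inr * (v.re * (outer s).im - v.im * (outer s).re)) * h

lemma IsOrbit.outer_mul {v : ℂ} {w : List (ZMod 5)} (h : IsOrbit v w) (k : ZMod 5) :
    IsOrbit (outer k * v) (w.map (· + k)) := by
  obtain ⟨l, hl, hw⟩ := h
  refine ⟨l.map fun a => (a.1 + k, a.2), hl.map ?_ ?_, ?_⟩
  · rintro ⟨a, y⟩ ⟨b, z⟩ h
    simpa using h
  · intro a b h
    simpa only [Step, width_outer_mul, offset_outer_mul] using h
  · have := hw.map (· + k)
    rw [List.map_map] at this ⊢
    exact this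

lemma width_mul (c : ℝ) (v : ℂ) (s : ZMod 5) : width (c * v) s = c * width v s := by
  simp [width, ip]
  ring

lemma offset_mul (c : ℝ) (v : ℂ) (s : ZMod 5) : offset (c * v) s = c * offset v s := by
  simp [offset, det]
  ring

lemma IsOrbit.mul_of_pos {v : ℂ} {w : List (ZMod 5)} (h : IsOrbit v w) {c : ℝ} (hc : 0 < c) :
    IsOrbit (c * v) w := by
  obtain ⟨l, hl, hw⟩ := h
  refine ⟨l.map fun a => (a.1, c * a.2), hl.map ?_ ?_, ?_⟩
  · rintro ⟨a, y⟩ ⟨b, z⟩ h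
    simpa [hc.ne'] using h
  · intro a b h
    have hneg : ∀ x : ℝ, c * x < 0 ↔ x < 0 := fun x =>
      ⟨fun h => by_contra fun h' => absurd h (not_lt.2 (mul_nonneg hc.le (not_lt.1 h'))),
        mul_neg_of_pos_of_neg hc⟩
    simp only [Step, width_mul, offset_mul, abs_mul, abs_of_pos hc, mul_lt_mul_iff_right₀ hc, hneg,
      mul_pos_iff_of_pos_left hc, ← mul_add, ← mul_sub,
      mul_right_inj' hc.ne']
    exact h
  · rw [List.map_map]
    exact hw

lemma IsOrbit.mul {v : ℂ} {w : List (ZMod 5)} (h : IsOrbit v w) {c : ℝ} (hc : c ≠ 0) :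
    IsOrbit (c * v) w := by
  rcases hc.lt_or_gt with hc | hc
  · rw [← isOrbit_neg] at h
    have := h.mul_of_pos (neg_pos.2 hc)
    push_cast at this
    rwa [neg_mul_neg] at this
  · exact h.mul_of_pos hc

/-! ## The reduction of cyclic words -/

lemma filter_isRotated {β : Type*} (p : β → Bool) {l l' : List β} (h : l ~r l') :
    l.filter p ~r l'.filter p := by
  obtain ⟨n, rfl⟩ := h
  rw [List.rotate_eq_drop_append_take_mod, List.filter_append]
  nth_rewrite 1 [← List.take_append_drop (n % l.length) l]
  rw [List.filter_append]
  exact List.isRotated_append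

lemma reduce_isRotated {w w' : List (ZMod 5)} (h : w ~r w') : reduce w ~r reduce w' := by
  obtain ⟨n, rfl⟩ := h
  refine (filter_isRotated _ ?_).map _
  refine ⟨n, ?_⟩
  rw [List.zip, List.zipWith_rotate_distrib _ _ _ _ (by simp), List.zip,
    List.zipWith_rotate_distrib _ _ _ _ (by simp)]
  rw [List.length_rotate, List.rotate_rotate, List.rotate_rotate, List.rotate_rotate,
    List.rotate_rotate, add_comm n, add_comm n]

/-- Turns the combinatorial condition on the two neighbours into a condition on the crossing itself,
so that reduction becomes a filter of crossings. -/
lemma reduce_map_fst {r : Crossing → Crossing → Prop} {l : List Crossing} {P : Crossing → Bool}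
    (hl : Cycle.Chain r (l : Cycle Crossing))
    (hP : ∀ a b c, r a b → r b c → (a.1 = c.1 ↔ P b = true)) :
    reduce (l.map Prod.fst) = (l.filter P).map Prod.fst := by
  rcases eq_or_ne l [] with rfl | hne
  · rfl
  have hpos := List.length_pos_of_ne_nil hne
  have hchain := (cycle_chain_iff_getElem hne).1 hl
  set T := l.zip ((l.rotate (l.length - 1)).zip (l.rotate 1)) with hT
  have h1 : reduce (l.map Prod.fst) =
      (T.filter fun t => decide (t.2.1.1 = t.2.2.1)).map fun t => t.1.1 := by
    rw [reduce, List.length_map, ← List.map_rotate, ← List.map_rotate, List.zip_map, List.zip_map,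
      ← hT, List.filter_map, List.map_map]
    rfl
  have h2 : l = T.map Prod.fst := by
    rw [hT, List.map_fst_zip]
    simp
  rw [h1]
  have h3 : l.filter P = (T.filter (P ∘ Prod.fst)).map Prod.fst := by
    rw [← List.filter_map, ← h2]
  rw [h3, List.map_map]
  congr 1
  refine List.filter_congr ?_
  intro t ht
  obtain ⟨i, hi, rfl⟩ := List.getElem_of_mem ht
  have hi' : i < l.length := by
    simp only [hT, List.length_zip, List.length_rotate] at hi
    omega
  have hm : (i + (l.length - 1)) % l.length < l.length := Nat.mod_lt _ hpos
  have h3 := hchain _ hm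
  have h4 := hchain i hi'
  have e : ((i + (l.length - 1)) % l.length + 1) % l.length = i := by
    rw [Nat.mod_add_mod, show i + (l.length - 1) + 1 = i + l.length by omega, Nat.add_mod_right,
      Nat.mod_eq_of_lt hi']
  simp only [e] at h3
  have h5 := hP _ _ _ h3 h4
  simp only [hT, List.getElem_zip, List.getElem_rotate, Function.comp]
  rw [Bool.eq_iff_iff, decide_eq_true_iff]
  exact h5

/-! ## A sector of directions

A direction strictly between two adjacent ideal vertices is a combination of these two with
coefficients `p, q > 0`; `P`, `Q` stand for the multiples of `p`, `q` by the golden ratio. -/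

/-- The inequalities between the coordinates of a direction in the open sector. -/
structure IsSector (p P q Q : ℝ) : Prop where
  p_pos : 0 < p
  lt_P : p < P
  P_lt : P < 2 * p
  q_pos : 0 < q
  lt_Q : q < Q
  Q_lt : Q < 2 * q

/-- The signed half widths of the sides. -/
def secWidth (p P q Q : ℝ) : ZMod 5 → ℝ := ![p, q, -(p + Q), P + Q, -(P + q)]

/-- The offsets of the sides, up to a common constant. -/
def secOffset (p P q Q : ℝ) : ZMod 5 → ℝ :=
  ![2 * P + p, -(2 * Q + q), 2 * P + p - Q, P - Q, P - 2 * Q - q]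

/-- The place of a side in the order in which consecutive sides can be crossed one after the other
by trajectories with directions in the sector. -/
def place : ZMod 5 → ℕ := ![4, 0, 3, 2, 1]

/-- The side at a given place. -/
def labelAt : ℕ → ZMod 5
  | 0 => 1
  | 1 => 4
  | 2 => 3
  | 3 => 2
  | _ => 0

/-- The orientation of the transversal coordinate on a side. -/
def twist : ZMod 5 → ℝ := ![-1, -1, 1, -1, 1]

lemma zmod_five_cases (s : ZMod 5) : s = 0 ∨ s = 1 ∨ s = 2 ∨ s = 3 ∨ s = 4 := by
  revert s
  decide

section values

variable (p P q Q : ℝ)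

lemma secWidth_zero : secWidth p P q Q 0 = p := rfl
lemma secWidth_one : secWidth p P q Q 1 = q := rfl
lemma secWidth_two : secWidth p P q Q 2 = -(p + Q) := rfl
lemma secWidth_three : secWidth p P q Q 3 = P + Q := rfl
lemma secWidth_four : secWidth p P q Q 4 = -(P + q) := rfl
lemma secOffset_zero : secOffset p P q Q 0 = 2 * P + p := rfl
lemma secOffset_one : secOffset p P q Q 1 = -(2 * Q + q) := rfl
lemma secOffset_two : secOffset p P q Q 2 = 2 * P + p - Q := rfl
lemma secOffset_three : secOffset p P q Q 3 = P - Q := rfl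
lemma secOffset_four : secOffset p P q Q 4 = P - 2 * Q - q := rfl
lemma twist_zero : twist 0 = -1 := rfl
lemma twist_one : twist 1 = -1 := rfl
lemma twist_two : twist 2 = 1 := rfl
lemma twist_three : twist 3 = -1 := rfl
lemma twist_four : twist 4 = 1 := rfl
lemma place_zero : place 0 = 4 := rfl
lemma place_one : place 1 = 0 := rfl
lemma place_two : place 2 = 3 := rfl
lemma place_three : place 3 = 2 := rfl
lemma place_four : place 4 = 1 := rfl

end values

lemma twist_eq (s : ZMod 5) : twist s = 1 ∨ twist s = -1 := by
  rcases zmod_five_cases s with rfl | rfl | rfl | rfl | rfl <;> simp [twist_zero, twist_one,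
    twist_two, twist_three, twist_four]

lemma abs_twist_mul (s : ZMod 5) (y : ℝ) : |twist s * y| = |y| := by
  rcases twist_eq s with h | h <;> simp [h]

lemma place_injective : Function.Injective place := by decide

lemma labelAt_place (s : ZMod 5) : labelAt (place s) = s := by
  revert s
  decide

lemma place_le (s : ZMod 5) : place s ≤ 4 := by
  revert s
  decide

lemma place_labelAt {k : ℕ} (hk : k ≤ 4) : place (labelAt k) = k := by
  interval_cases k <;> rfl

/-! ### Walks on the path of places -/

section sector

variable {p P q Q : ℝ}

lemma abs_secWidth (h : IsSector p P q Q) (s : ZMod 5) :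
    |secWidth p P q Q s| = twist s * -secWidth p P q Q s := by
  obtain ⟨h1, h2, h3, h4, h5, h6⟩ := h
  rcases zmod_five_cases s with rfl | rfl | rfl | rfl | rfl <;>
    simp only [secWidth_zero, secWidth_one, secWidth_two, secWidth_three, secWidth_four, twist_zero,
      twist_one, twist_two, twist_three, twist_four]
  · rw [abs_of_pos h1]; ring
  · rw [abs_of_pos h4]; ring
  · rw [abs_of_neg (by linarith)]; ring
  · rw [abs_of_pos (by linarith)]; ring
  · rw [abs_of_neg (by linarith)]; ring

/-- Consecutive crossings have consecutive places; the inequalities say through which end of a side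
the trajectory leaves and arrives. -/
lemma step_cases (h : IsSector p P q Q) {a b : Crossing}
    (hs : Step (secWidth p P q Q) (secOffset p P q Q) a b) :
    (place b.1 = place a.1 + 1 ∧ secWidth p P (-q) (-Q) a.1 < twist a.1 * a.2 ∧
        -secWidth p P (-q) (-Q) b.1 < twist b.1 * b.2 ∧
        b.2 - a.2 = secOffset p P (-q) (-Q) b.1 - secOffset p P (-q) (-Q) a.1) ∨
      (place a.1 = place b.1 + 1 ∧ twist a.1 * a.2 < secWidth p P (-q) (-Q) a.1 ∧
        twist b.1 * b.2 < -secWidth p P (-q) (-Q) b.1 ∧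
        b.2 - a.2 = secOffset p P (-q) (-Q) a.1 - secOffset p P (-q) (-Q) b.1) := by
  obtain ⟨s, y⟩ := a
  obtain ⟨s', y'⟩ := b
  obtain ⟨ha, hb, hs⟩ := hs
  rw [abs_secWidth h, abs_lt] at ha hb
  obtain ⟨ha1, ha2⟩ := ha
  obtain ⟨hb1, hb2⟩ := hb
  obtain ⟨h1, h2, h3, h4, h5, h6⟩ := h
  dsimp only at *
  -- For each pair of labels and each of the pentagons `P`, `-P`, either the inequalities are
  -- contradictory or the places are adjacent. Using the reflected offsets gives one formula along a
  -- rising run, although the chords lie alternately in `P` and `-P`.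
  rcases zmod_five_cases s with rfl | rfl | rfl | rfl | rfl <;>
  rcases zmod_five_cases s' with rfl | rfl | rfl | rfl | rfl <;>
  simp only [secWidth_zero, secWidth_one, secWidth_two, secWidth_three, secWidth_four, twist_zero,
      twist_one, twist_two, twist_three, twist_four, secOffset_zero, secOffset_one, secOffset_two,
      secOffset_three, secOffset_four] at * <;>
  rcases hs with ⟨h7, h8, h9⟩ | ⟨h7, h8, h9⟩ <;>
  first
  | (exfalso; linarith)
  | exact Or.inl ⟨rfl, by linarith, by linarith, by linarith⟩
  | exact Or.inr ⟨rfl, by linarith, by linarith, by linarith⟩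

/-- The signs of the widths alternate with the place, so the pair of labels already decides whether
the chord lies in `P` or in `-P`. -/
lemma step_of_place_eq_add_one (h : IsSector p P q Q) {a b : Crossing}
    (hab : place b.1 = place a.1 + 1) (ha : |a.2| < |secWidth p P q Q a.1|)
    (hb : |b.2| < |secWidth p P q Q b.1|)
    (hy : b.2 - a.2 = secOffset p P (-q) (-Q) b.1 - secOffset p P (-q) (-Q) a.1) :
    Step (secWidth p P q Q) (secOffset p P q Q) a b := by
  refine ⟨ha, hb, ?_⟩
  obtain ⟨s, y⟩ := a
  obtain ⟨s', y'⟩ := b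
  obtain ⟨h1, h2, h3, h4, h5, h6⟩ := h
  clear ha hb
  dsimp only at *
  rcases zmod_five_cases s with rfl | rfl | rfl | rfl | rfl <;>
  rcases zmod_five_cases s' with rfl | rfl | rfl | rfl | rfl <;>
  first
  | (exfalso; revert hab; decide)
  | (simp only [secWidth_zero, secWidth_one, secWidth_two, secWidth_three, secWidth_four,
      secOffset_zero, secOffset_one, secOffset_two, secOffset_three, secOffset_four] at *
     first
     | exact Or.inl ⟨by linarith, by linarith, by linarith⟩
     | exact Or.inr ⟨by linarith, by linarith, by linarith⟩)

lemma step_of_place_add_one_eq (h : IsSector p P q Q) {a b : Crossing}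
    (hab : place a.1 = place b.1 + 1) (ha : |a.2| < |secWidth p P q Q a.1|)
    (hb : |b.2| < |secWidth p P q Q b.1|)
    (hy : b.2 - a.2 = secOffset p P (-q) (-Q) a.1 - secOffset p P (-q) (-Q) b.1) :
    Step (secWidth p P q Q) (secOffset p P q Q) a b := by
  refine ⟨ha, hb, ?_⟩
  obtain ⟨s, y⟩ := a
  obtain ⟨s', y'⟩ := b
  obtain ⟨h1, h2, h3, h4, h5, h6⟩ := h
  clear ha hb
  dsimp only at *
  rcases zmod_five_cases s with rfl | rfl | rfl | rfl | rfl <;>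
  rcases zmod_five_cases s' with rfl | rfl | rfl | rfl | rfl <;>
  first
  | (exfalso; revert hab; decide)
  | (simp only [secWidth_zero, secWidth_one, secWidth_two, secWidth_three, secWidth_four,
      secOffset_zero, secOffset_one, secOffset_two, secOffset_three, secOffset_four] at *
     first
     | exact Or.inl ⟨by linarith, by linarith, by linarith⟩
     | exact Or.inr ⟨by linarith, by linarith, by linarith⟩)

/-- A chord of the reflected direction through `P` goes up in the order of the places. -/
lemma place_lt_place (h : IsSector p P q Q) {s s' : ZMod 5} {y y' : ℝ}
    (hs : secWidth p P (-q) (-Q) s < 0) (hs' : 0 < secWidth p P (-q) (-Q) s')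
    (hy1 : secWidth p P (-q) (-Q) s < y) (hy2 : y < -secWidth p P (-q) (-Q) s)
    (hy1' : -secWidth p P (-q) (-Q) s' < y') (hy2' : y' < secWidth p P (-q) (-Q) s')
    (e : y' - y = secOffset p P (-q) (-Q) s' - secOffset p P (-q) (-Q) s) :
    place s < place s' := by
  obtain ⟨h1, h2, h3, h4, h5, h6⟩ := h
  rcases zmod_five_cases s with rfl | rfl | rfl | rfl | rfl <;>
  rcases zmod_five_cases s' with rfl | rfl | rfl | rfl | rfl <;>
  simp only [secWidth_zero, secWidth_one, secWidth_two, secWidth_three, secWidth_four,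
      secOffset_zero, secOffset_one, secOffset_two,
      secOffset_three, secOffset_four] at * <;>
  first
  | (exfalso; linarith)
  | decide

/-- Between its ends, such a chord meets the sides of the intermediate places outside of the part
where trajectories turn. -/
lemma width_lt_of_between (h : IsSector p P q Q) {s s' x : ZMod 5} {y y' z : ℝ}
    (hs : secWidth p P (-q) (-Q) s < 0) (hs' : 0 < secWidth p P (-q) (-Q) s')
    (hy1 : secWidth p P (-q) (-Q) s < y) (hy2 : y < -secWidth p P (-q) (-Q) s)
    (hy1' : -secWidth p P (-q) (-Q) s' < y') (hy2' : y' < secWidth p P (-q) (-Q) s')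
    (e : y' - y = secOffset p P (-q) (-Q) s' - secOffset p P (-q) (-Q) s)
    (e' : z - y = secOffset p P (-q) (-Q) x - secOffset p P (-q) (-Q) s)
    (hsx : place s < place x) (hxs : place x < place s') :
    secWidth p P (-q) (-Q) x < twist x * z ∧ -secWidth p P (-q) (-Q) x < twist x * z ∧
      twist x * z < twist x * -secWidth p P q Q x := by
  obtain ⟨h1, h2, h3, h4, h5, h6⟩ := h
  rcases zmod_five_cases s with rfl | rfl | rfl | rfl | rfl <;>
  rcases zmod_five_cases s' with rfl | rfl | rfl | rfl | rfl <;>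
  first
  | (exfalso; have := hsx.trans hxs; revert this; decide)
  | (rcases zmod_five_cases x with rfl | rfl | rfl | rfl | rfl <;>
     first
     | (exfalso; revert hsx; decide)
     | (exfalso; revert hxs; decide)
     | (simp only [secWidth_zero, secWidth_one, secWidth_two, secWidth_three, secWidth_four,
          secOffset_zero, secOffset_one, secOffset_two, secOffset_three, secOffset_four, twist_two,
          twist_three, twist_four] at *
        exact ⟨by linarith, by linarith, by linarith⟩))

/-- Changing the sign of `q` can only cause cancellation in a width. Hence a crossing of the
reflected direction remains inside its side for the original direction. -/
lemma abs_flip_lt (h : IsSector p P q Q) (s : ZMod 5) :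
    |secWidth p P (-q) (-Q) s| ≤ |secWidth p P q Q s| := by
  rw [abs_secWidth h, abs_le]
  obtain ⟨h1, h2, h3, h4, h5, h6⟩ := h
  rcases zmod_five_cases s with rfl | rfl | rfl | rfl | rfl <;>
  simp only [secWidth_zero, secWidth_one, secWidth_two, secWidth_three, secWidth_four, twist_zero,
      twist_one, twist_two, twist_three, twist_four] <;>
  exact ⟨by linarith, by linarith⟩

end sector

section cycles

/-! ## Filling a word -/

/-- The labels of the sides crossed from `s` on, until `s'` is reached. -/
def run (s s' : ZMod 5) : List (ZMod 5) :=
  if place s < place s' then (List.range (place s' - place s)).map fun i => labelAt (place s + i)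
  else (List.range (place s - place s')).map fun i => labelAt (place s - i)

/-- The concatenation of the runs between the consecutive symbols of a word. -/
def fill : List (ZMod 5) → List (ZMod 5)
  | a :: b :: l => run a b ++ fill (b :: l)
  | _ => []

/-- The concatenation of the runs between the consecutive symbols of a cyclic word. -/
def fillCyclic : List (ZMod 5) → List (ZMod 5)
  | [] => []
  | a :: l => fill (a :: (l ++ [a]))

lemma fill_cons_cons (a b : ZMod 5) (l : List (ZMod 5)) :
    fill (a :: b :: l) = run a b ++ fill (b :: l) := rfl

lemma fill_singleton (a : ZMod 5) : fill [a] = [] := rfl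

/-- A run omits its last symbol, so two pieces of a word must overlap in one symbol for their
fillings to concatenate. -/
lemma fill_append (l : List (ZMod 5)) (b : ZMod 5) (l' : List (ZMod 5)) :
    fill (l ++ b :: l') = fill (l ++ [b]) ++ fill (b :: l') := by
  induction l with
  | nil => rfl
  | cons a l ih =>
    cases l with
    | nil => simp [fill_cons_cons, fill_singleton]
    | cons c l =>
      simp only [List.cons_append] at ih ⊢
      rw [fill_cons_cons, fill_cons_cons, ih, List.append_assoc]

lemma fillCyclic_isRotated {w w' : List (ZMod 5)} (h : w ~r w') :
    fillCyclic w ~r fillCyclic w' := by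
  obtain ⟨n, rfl⟩ := h
  induction n with
  | zero => rw [List.rotate_zero]
  | succ n ih =>
    refine ih.trans ?_
    rw [← List.rotate_rotate]
    generalize w.rotate n = u
    cases u with
    | nil => exact List.IsRotated.refl _
    | cons a l =>
      rw [List.rotate_cons_succ, List.rotate_zero]
      cases l with
      | nil => exact List.IsRotated.refl _
      | cons b l =>
        simp only [List.cons_append, fillCyclic]
        rw [fill_cons_cons, List.append_assoc, List.singleton_append, ← List.cons_append,
          ← List.cons_append, fill_append (b :: l) a [b], fill_cons_cons a b, fill_singleton,
          List.append_nil]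
        exact List.isRotated_append

lemma run_of_place {s s' : ZMod 5} (h : place s' = place s + 1 ∨ place s = place s' + 1) :
    run s s' = [s] := by
  revert h
  revert s s'
  decide

lemma run_append_up {s x x' : ZMod 5} (h : place s < place x) (h' : place x' = place x + 1) :
    run s x ++ [x] = run s x' := by
  revert h h'
  revert s x x'
  decide

lemma run_append_down {s x x' : ZMod 5} (h : place x < place s) (h' : place x = place x' + 1) :
    run s x ++ [x] = run s x' := by
  revert h h'
  revert s x x'
  decide

/-! ## Turning crossings -/

/-- The image of a crossing under the affine reflection of the surface that preserves the two ends
of the sector. -/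
def mirror (a : Crossing) : Crossing := (a.1, -a.2)

lemma mirror_injective : Function.Injective mirror := by
  rintro ⟨a, y⟩ ⟨b, z⟩ h
  simpa [mirror] using h

/-- A trajectory turns at a crossing, in the order of the places, if its coordinate is smaller than
the half width of the reflected side. -/
def IsTurn (A' : ZMod 5 → ℝ) (a : Crossing) : Prop := |a.2| < |A' a.1|

/-- A trajectory may get from the turning crossing `a` to `c` without turning in between. -/
def InRun (A' B' : ZMod 5 → ℝ) (a c : Crossing) : Prop :=
  A' a.1 < 0 ∧ place a.1 < place c.1 ∧ -A' c.1 < twist c.1 * c.2 ∧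
      c.2 - a.2 = B' c.1 - B' a.1 ∨
    0 < A' a.1 ∧ place c.1 < place a.1 ∧ twist c.1 * c.2 < -A' c.1 ∧
      c.2 - a.2 = B' a.1 - B' c.1

variable {p P q Q : ℝ}

/-- A turn opens a new run: the sign of the reflected width decides whether it is a bottom turn,
followed by a rise, or a top turn, followed by a fall. -/
lemma IsTurn.inRun (h : IsSector p P q Q) {a b : Crossing}
    (ha : IsTurn (secWidth p P (-q) (-Q)) a)
    (hs : Step (secWidth p P q Q) (secOffset p P q Q) a b) :
    InRun (secWidth p P (-q) (-Q)) (secOffset p P (-q) (-Q)) a b ∧ run a.1 b.1 = [a.1] := by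
  rw [IsTurn, ← abs_twist_mul a.1] at ha
  rcases step_cases h hs with ⟨h1, h2, h3, h4⟩ | ⟨h1, h2, h3, h4⟩
  · refine ⟨Or.inl ⟨?_, by omega, h3, h4⟩, run_of_place (Or.inl h1)⟩
    by_contra hc
    rw [abs_of_nonneg (not_lt.1 hc)] at ha
    linarith [le_abs_self (twist a.1 * a.2)]
  · refine ⟨Or.inr ⟨?_, by omega, h3, h4⟩, run_of_place (Or.inr h1)⟩
    by_contra hc
    rw [abs_of_nonpos (not_lt.1 hc)] at ha
    linarith [neg_abs_le (twist a.1 * a.2)]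

/-- Without a turn the walk continues in the same direction, and the coordinate minus (rising) or
plus (falling) the reflected offset is preserved. -/
lemma InRun.step (h : IsSector p P q Q) {a c d : Crossing}
    (ha : InRun (secWidth p P (-q) (-Q)) (secOffset p P (-q) (-Q)) a c)
    (hc : ¬ IsTurn (secWidth p P (-q) (-Q)) c)
    (hs : Step (secWidth p P q Q) (secOffset p P q Q) c d) :
    InRun (secWidth p P (-q) (-Q)) (secOffset p P (-q) (-Q)) a d ∧
      run a.1 c.1 ++ [c.1] = run a.1 d.1 := by
  rw [IsTurn, ← abs_twist_mul c.1] at hc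
  rcases ha with ⟨h1, h2, h3, h4⟩ | ⟨h1, h2, h3, h4⟩ <;>
    rcases step_cases h hs with ⟨h5, h6, h7, h8⟩ | ⟨h5, h6, h7, h8⟩
  · exact ⟨Or.inl ⟨h1, by omega, h7, by linarith⟩, run_append_up h2 h5⟩
  · refine absurd (abs_lt.2 ⟨?_, ?_⟩) hc <;>
      linarith [le_abs_self (secWidth p P (-q) (-Q) c.1)]
  · refine absurd (abs_lt.2 ⟨?_, ?_⟩) hc <;>
      linarith [neg_abs_le (secWidth p P (-q) (-Q) c.1)]
  · exact ⟨Or.inr ⟨h1, by omega, h7, by linarith⟩, run_append_down h2 h5⟩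

/-- The quantity conserved along a run becomes, after negating coordinates, the transversal
coordinate in `P` (rising) or `-P` (falling) in the reflected direction. -/
lemma InRun.step_mirror {A' B' : ZMod 5 → ℝ} {a c : Crossing} (h : InRun A' B' a c)
    (ha : IsTurn A' a) (hc : IsTurn A' c) : Step A' B' (mirror a) (mirror c) := by
  have hc' := hc
  rw [IsTurn, ← abs_twist_mul c.1] at hc
  refine ⟨by rwa [mirror, abs_neg], by rwa [mirror, abs_neg], ?_⟩
  rcases h with ⟨h1, h2, h3, h4⟩ | ⟨h1, h2, h3, h4⟩
  · refine Or.inl ⟨h1, ?_, ?_⟩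
    · by_contra hn
      simp only [mirror] at hn
      rw [abs_of_nonpos (not_lt.1 hn)] at hc
      linarith [le_abs_self (twist c.1 * c.2)]
    · simp only [mirror]
      linarith
  · refine Or.inr ⟨h1, ?_, ?_⟩
    · by_contra hn
      simp only [mirror] at hn
      rw [abs_of_nonneg (not_lt.1 hn)] at hc
      linarith [neg_abs_le (twist c.1 * c.2)]
    · simp only [mirror]
      linarith

/-- One inequality tells from which neighbour the walk arrives, another to which it departs. These
neighbours coincide exactly if the coordinate lies between the two thresholds `±A'`. -/
lemma sandwiched_iff_isTurn (h : IsSector p P q Q) {a b c : Crossing}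
    (h1 : Step (secWidth p P q Q) (secOffset p P q Q) a b)
    (h2 : Step (secWidth p P q Q) (secOffset p P q Q) b c) :
    a.1 = c.1 ↔ IsTurn (secWidth p P (-q) (-Q)) b := by
  rw [IsTurn, ← abs_twist_mul b.1]
  rcases step_cases h h1 with ⟨h3, h4, h5, h6⟩ | ⟨h3, h4, h5, h6⟩ <;>
    rcases step_cases h h2 with ⟨h7, h8, h9, h10⟩ | ⟨h7, h8, h9, h10⟩
  · refine iff_of_false (fun e => ?_) (not_lt.2 ?_)
    · rw [e] at h3
      omega
    · exact (abs_le.2 ⟨by linarith, by linarith⟩).trans (le_abs_self _)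
  · refine iff_of_true (place_injective (by omega)) ?_
    exact lt_of_lt_of_le (abs_lt.2 ⟨by linarith, h8⟩) (le_abs_self _)
  · refine iff_of_true (place_injective (by omega)) ?_
    exact lt_of_lt_of_le (abs_lt.2 ⟨by linarith, by linarith⟩) (neg_le_abs _)
  · refine iff_of_false (fun e => ?_) (not_lt.2 ?_)
    · rw [e] at h3
      omega
    · exact (abs_le.2 ⟨by linarith, by linarith⟩).trans (neg_le_abs _)

open Classical in
/-- The turning crossings of a cyclic sequence of crossings. -/
def turns (A' : ZMod 5 → ℝ) (l : List Crossing) : List Crossing :=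
  l.filter fun a => decide (IsTurn A' a)

lemma turns_cons_of_isTurn {A' : ZMod 5 → ℝ} {a : Crossing} (h : IsTurn A' a) (l : List Crossing) :
    turns A' (a :: l) = a :: turns A' l := by
  simp [turns, h]

lemma turns_cons_of_not_isTurn {A' : ZMod 5 → ℝ} {a : Crossing} (h : ¬ IsTurn A' a)
    (l : List Crossing) : turns A' (a :: l) = turns A' l := by
  simp [turns, h]

lemma turns_append (A' : ZMod 5 → ℝ) (l l' : List Crossing) :
    turns A' (l ++ l') = turns A' l ++ turns A' l' :=
  List.filter_append ..

/-- The induction carries the last turn `a`, the current crossing `c` of its run and the final turn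
`b`; `run a.1 c.1` is the part of the word already consumed. -/
lemma isChain_turns (h : IsSector p P q Q) (M : List Crossing) :
    ∀ a c b : Crossing, IsTurn (secWidth p P (-q) (-Q)) a → IsTurn (secWidth p P (-q) (-Q)) b →
      InRun (secWidth p P (-q) (-Q)) (secOffset p P (-q) (-Q)) a c →
      List.IsChain (Step (secWidth p P q Q) (secOffset p P q Q)) (c :: (M ++ [b])) →
      List.IsChain (Step (secWidth p P (-q) (-Q)) (secOffset p P (-q) (-Q)))
          ((a :: (turns (secWidth p P (-q) (-Q)) (c :: M) ++ [b])).map mirror) ∧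
        fill ((a :: (turns (secWidth p P (-q) (-Q)) (c :: M) ++ [b])).map Prod.fst) =
          run a.1 c.1 ++ (c :: M).map Prod.fst := by
  induction M with
  | nil =>
    intro a c b ha hb hac hch
    simp only [List.nil_append, List.isChain_pair] at hch
    by_cases hc : IsTurn (secWidth p P (-q) (-Q)) c
    · obtain ⟨h1, h2⟩ := hc.inRun h hch
      rw [turns_cons_of_isTurn hc]
      simp only [turns, List.filter_nil, List.cons_append, List.nil_append, List.map_cons,
        List.map_nil, List.isChain_cons_cons, List.isChain_singleton, and_true]
      refine ⟨⟨hac.step_mirror ha hc, h1.step_mirror hc hb⟩, ?_⟩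
      simp [fill_cons_cons, fill_singleton, h2]
    · obtain ⟨h1, h2⟩ := hac.step h hc hch
      rw [turns_cons_of_not_isTurn hc]
      simp only [turns, List.filter_nil, List.nil_append, List.map_cons,
        List.map_nil, List.isChain_cons_cons, List.isChain_singleton, and_true]
      refine ⟨h1.step_mirror ha hb, ?_⟩
      simp [fill_cons_cons, fill_singleton, h2]
  | cons d M ih =>
    intro a c b ha hb hac hch
    rw [List.cons_append, List.isChain_cons_cons] at hch
    by_cases hc : IsTurn (secWidth p P (-q) (-Q)) c
    · obtain ⟨h1, h2⟩ := hc.inRun h hch.1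
      obtain ⟨h3, h4⟩ := ih c d b hc hb h1 hch.2
      rw [turns_cons_of_isTurn hc]
      simp only [List.cons_append, List.map_cons] at h3 h4 ⊢
      refine ⟨List.isChain_cons_cons.2 ⟨hac.step_mirror ha hc, h3⟩, ?_⟩
      rw [fill_cons_cons, h4, h2]
      rfl
    · obtain ⟨h1, h2⟩ := hac.step h hc hch.1
      obtain ⟨h3, h4⟩ := ih a d b ha hb h1 hch.2
      rw [turns_cons_of_not_isTurn hc]
      refine ⟨h3, ?_⟩
      rw [h4, ← h2]
      simp

lemma isChain_cyclic_turns (h : IsSector p P q Q) {a : Crossing} {l : List Crossing}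
    (ha : IsTurn (secWidth p P (-q) (-Q)) a)
    (hch : List.IsChain (Step (secWidth p P q Q) (secOffset p P q Q)) (a :: (l ++ [a]))) :
    List.IsChain (Step (secWidth p P (-q) (-Q)) (secOffset p P (-q) (-Q)))
        ((turns (secWidth p P (-q) (-Q)) (a :: l) ++ [a]).map mirror) ∧
      fillCyclic ((turns (secWidth p P (-q) (-Q)) (a :: l)).map Prod.fst) =
        (a :: l).map Prod.fst := by
  rw [turns_cons_of_isTurn ha]
  cases l with
  | nil =>
    simp only [List.nil_append, List.isChain_pair] at hch
    -- A crossing cannot follow itself, since consecutive places differ by one.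
    rcases step_cases h hch with ⟨h1, -⟩ | ⟨h1, -⟩ <;> omega
  | cons c M =>
    rw [List.cons_append, List.isChain_cons_cons] at hch
    obtain ⟨h1, h2⟩ := ha.inRun h hch.1
    obtain ⟨h3, h4⟩ := isChain_turns h M a c a ha ha h1 hch.2
    refine ⟨h3, ?_⟩
    rw [List.map_cons, List.map_append, List.map_cons, List.map_nil] at h4
    rw [List.map_cons, fillCyclic, h4, h2]
    rfl

/-! ## Filling a cycle of crossings -/

/-- A chord in the reflected direction is lifted by extending its linear coordinate to the
intermediate places, where the inequalities guarantee genuine crossings that are not turns. -/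
lemma exists_isChain_of_step_mirror (h : IsSector p P q Q) {a c : Crossing}
    (hs : Step (secWidth p P (-q) (-Q)) (secOffset p P (-q) (-Q)) (mirror a) (mirror c)) :
    IsTurn (secWidth p P (-q) (-Q)) a ∧ IsTurn (secWidth p P (-q) (-Q)) c ∧
      ∃ M, List.IsChain (Step (secWidth p P q Q) (secOffset p P q Q)) (a :: (M ++ [c])) ∧
        turns (secWidth p P (-q) (-Q)) M = [] ∧ a.1 :: M.map Prod.fst = run a.1 c.1 := by
  obtain ⟨ha, hc, hs⟩ := hs
  simp only [mirror, abs_neg] at ha hc hs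
  refine ⟨ha, hc, ?_⟩
  have hva : |a.2| < |secWidth p P q Q a.1| := ha.trans_le (abs_flip_lt h _)
  have hvc : |c.2| < |secWidth p P q Q c.1| := hc.trans_le (abs_flip_lt h _)
  rcases hs with ⟨h1, h2, h3⟩ | ⟨h1, h2, h3⟩
  · rw [abs_of_neg h1, abs_lt] at ha
    rw [abs_of_pos h2, abs_lt] at hc
    have hlt := place_lt_place h h1 h2 (by linarith) ha.2 hc.1 hc.2 (by linarith)
    have hle := place_le c.1
    let f : ℕ → Crossing := fun i => (labelAt (place a.1 + i),
      a.2 + secOffset p P (-q) (-Q) (labelAt (place a.1 + i)) - secOffset p P (-q) (-Q) a.1)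
    obtain ⟨n, hn⟩ := Nat.exists_eq_add_of_lt hlt
    have hf0 : f 0 = a := by simp [f, labelAt_place]
    have hfn : f (n + 1) = c := by
      simp only [f, ← add_assoc, ← hn, labelAt_place]
      exact Prod.ext rfl (by simp only; linarith)
    have hpl : ∀ i, i ≤ n + 1 → place (f i).1 = place a.1 + i := fun i hi =>
      place_labelAt (by omega)
    have hmid : ∀ i, i < n → ¬ IsTurn (secWidth p P (-q) (-Q)) (f (i + 1)) ∧
        |(f (i + 1)).2| < |secWidth p P q Q (f (i + 1)).1| := by
      intro i hi
      have h4 := hpl (i + 1) (by omega)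
      obtain ⟨h5, h6, h7⟩ := width_lt_of_between (x := (f (i + 1)).1) (z := (f (i + 1)).2) h h1 h2
        (by linarith) ha.2 hc.1 hc.2 (by linarith) (by simp only [f]; ring) (by omega) (by omega)
      -- Here the twisted coordinate is at least `|A'|`, hence nonnegative and equal to the absolute
      -- value of the coordinate: it is too large for a turn, yet small enough for a crossing.
      have h8 := (abs_le (a := secWidth p P (-q) (-Q) (f (i + 1)).1)
        (b := twist (f (i + 1)).1 * (f (i + 1)).2)).2 ⟨by linarith, by linarith⟩
      have h9 := abs_of_nonneg ((abs_nonneg _).trans h8)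
      rw [abs_twist_mul] at h9
      rw [IsTurn, h9, abs_secWidth h]
      exact ⟨not_lt.2 h8, h7⟩
    have hval : ∀ i, i ≤ n + 1 → |(f i).2| < |secWidth p P q Q (f i).1| := by
      intro i hi
      rcases Nat.eq_zero_or_pos i with rfl | h0
      · rwa [hf0]
      · obtain ⟨i, rfl⟩ := Nat.exists_eq_add_one.2 h0
        rcases Nat.lt_or_ge i n with h4 | h4
        · exact (hmid i h4).2
        · obtain rfl : i = n := by omega
          rwa [hfn]
    refine ⟨(List.range n).map fun i => f (i + 1), ?_, ?_, ?_⟩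
    · have e : a :: ((List.range n).map (fun i => f (i + 1)) ++ [c]) =
          (List.range (n + 2)).map f := by
        rw [List.range_succ, List.range_succ_eq_map]
        simp [hf0, hfn, Function.comp_def]
      rw [e, List.isChain_iff_getElem]
      intro i hi
      simp only [List.length_map, List.length_range] at hi
      simp only [List.getElem_map, List.getElem_range]
      refine step_of_place_eq_add_one h ?_ (hval _ (by omega)) (hval _ (by omega)) ?_
      · rw [hpl _ (by omega), hpl _ (by omega), add_assoc]
      · simp only [f]
        ring
    · simp only [turns, List.filter_eq_nil_iff, List.mem_map, List.mem_range]
      rintro _ ⟨i, hi, rfl⟩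
      simpa using (hmid i hi).1
    · rw [run, if_pos hlt, show place c.1 - place a.1 = n + 1 by omega, List.range_succ_eq_map]
      simp [f, labelAt_place, Function.comp_def]
  · rw [abs_of_pos h1, abs_lt] at ha
    rw [abs_of_neg h2, abs_lt] at hc
    -- A falling chord is traversed backwards with negated coordinates, which makes it a rising
    -- chord of `P`.
    have hlt := place_lt_place (y := -c.2) (y' := -a.2) h h2 h1 (by linarith) (by linarith)
      (by linarith) (by linarith) (by linarith)
    have hle := place_le a.1
    let f : ℕ → Crossing := fun i => (labelAt (place a.1 - i),
      a.2 + secOffset p P (-q) (-Q) a.1 - secOffset p P (-q) (-Q) (labelAt (place a.1 - i)))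
    obtain ⟨n, hn⟩ := Nat.exists_eq_add_of_lt hlt
    have hf0 : f 0 = a := by simp [f, labelAt_place]
    have hfn : f (n + 1) = c := by
      simp only [f, show place a.1 - (n + 1) = place c.1 by omega, labelAt_place]
      exact Prod.ext rfl (by simp only; linarith)
    have hpl : ∀ i, i ≤ n + 1 → place (f i).1 = place a.1 - i := fun i hi =>
      place_labelAt (by omega)
    have hmid : ∀ i, i < n → ¬ IsTurn (secWidth p P (-q) (-Q)) (f (i + 1)) ∧
        |(f (i + 1)).2| < |secWidth p P q Q (f (i + 1)).1| := by
      intro i hi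
      have h4 := hpl (i + 1) (by omega)
      obtain ⟨h5, h6, h7⟩ := width_lt_of_between (x := (f (i + 1)).1) (z := -(f (i + 1)).2)
        (y := -c.2) (y' := -a.2) h h2 h1
        (by linarith) (by linarith) (by linarith) (by linarith) (by linarith)
        (by simp only [f]; linarith) (by omega) (by omega)
      have h8 := (abs_le (a := secWidth p P (-q) (-Q) (f (i + 1)).1)
        (b := twist (f (i + 1)).1 * -(f (i + 1)).2)).2 ⟨by linarith, by linarith⟩
      have h9 := abs_of_nonneg ((abs_nonneg _).trans h8)
      rw [abs_twist_mul, abs_neg] at h9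
      rw [IsTurn, h9, abs_secWidth h]
      exact ⟨not_lt.2 h8, h7⟩
    have hval : ∀ i, i ≤ n + 1 → |(f i).2| < |secWidth p P q Q (f i).1| := by
      intro i hi
      rcases Nat.eq_zero_or_pos i with rfl | h0
      · rwa [hf0]
      · obtain ⟨i, rfl⟩ := Nat.exists_eq_add_one.2 h0
        rcases Nat.lt_or_ge i n with h4 | h4
        · exact (hmid i h4).2
        · obtain rfl : i = n := by omega
          rwa [hfn]
    refine ⟨(List.range n).map fun i => f (i + 1), ?_, ?_, ?_⟩
    · have e : a :: ((List.range n).map (fun i => f (i + 1)) ++ [c]) =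
          (List.range (n + 2)).map f := by
        rw [List.range_succ, List.range_succ_eq_map]
        simp [hf0, hfn, Function.comp_def]
      rw [e, List.isChain_iff_getElem]
      intro i hi
      simp only [List.length_map, List.length_range] at hi
      simp only [List.getElem_map, List.getElem_range]
      refine step_of_place_add_one_eq h ?_ (hval _ (by omega)) (hval _ (by omega)) ?_
      · rw [hpl _ (by omega), hpl _ (by omega)]
        omega
      · simp only [f]
        ring
    · simp only [turns, List.filter_eq_nil_iff, List.mem_map, List.mem_range]
      rintro _ ⟨i, hi, rfl⟩
      simpa using (hmid i hi).1
    · rw [run, if_neg (by omega), show place a.1 - place c.1 = n + 1 by omega,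
        List.range_succ_eq_map]
      simp [f, labelAt_place, Function.comp_def]

/-- Filling in the crossings between the turning ones. -/
lemma exists_isChain_fill (h : IsSector p P q Q) (l : List Crossing) :
    ∀ a b : Crossing, List.IsChain (Step (secWidth p P (-q) (-Q)) (secOffset p P (-q) (-Q)))
        ((a :: (l ++ [b])).map mirror) →
      ∃ M, List.IsChain (Step (secWidth p P q Q) (secOffset p P q Q)) (a :: (M ++ [b])) ∧
        turns (secWidth p P (-q) (-Q)) (a :: M) = a :: l ∧
        (a :: M).map Prod.fst = fill ((a :: (l ++ [b])).map Prod.fst) := by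
  induction l with
  | nil =>
    intro a b hch
    simp only [List.nil_append, List.map_cons, List.map_nil, List.isChain_pair] at hch
    obtain ⟨h1, -, M, h3, h4, h5⟩ := exists_isChain_of_step_mirror h hch
    refine ⟨M, h3, ?_, ?_⟩
    · rw [turns_cons_of_isTurn h1, h4]
    · simpa [fill_cons_cons, fill_singleton] using h5
  | cons c l ih =>
    intro a b hch
    rw [List.cons_append, List.map_cons, List.map_cons, List.isChain_cons_cons] at hch
    obtain ⟨h1, h2, M, h3, h4, h5⟩ := exists_isChain_of_step_mirror h hch.1
    obtain ⟨N, h6, h7, h8⟩ := ih c b hch.2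
    refine ⟨M ++ c :: N, ?_, ?_, ?_⟩
    · have e : a :: (M ++ c :: N ++ [b]) = (a :: M) ++ c :: (N ++ [b]) := by simp
      rw [e, List.isChain_split]
      exact ⟨h3, h6⟩
    · rw [turns_cons_of_isTurn h1, turns_append, h4, h7, List.nil_append]
    · rw [← List.cons_append, List.map_append, h8, List.map_cons, h5]
      simp [fill_cons_cons]

/-! ## The correspondence of cycles of crossings -/

lemma cycle_chain_imp_of_mem {β : Type*} {r r' : β → β → Prop} {l : List β}
    (h : Cycle.Chain r (l : Cycle β)) (hr : ∀ a ∈ l, ∀ b ∈ l, r a b → r' a b) :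
    Cycle.Chain r' (l : Cycle β) := by
  rcases eq_or_ne l [] with rfl | hne
  · trivial
  rw [cycle_chain_iff_getElem hne] at h ⊢
  exact fun i hi => hr _ (List.getElem_mem _) _ (List.getElem_mem _) (h i hi)

lemma not_cycle_chain {β : Type*} {r : β → β → Prop} (htrans : ∀ a b c, r a b → r b c → r a c)
    (hirr : ∀ a, ¬ r a a) {l : List β} (hl : l ≠ []) : ¬ Cycle.Chain r (l : Cycle β) := by
  intro h
  have : IsTrans β r := ⟨htrans⟩
  obtain ⟨a, l, rfl⟩ := List.exists_cons_of_ne_nil hl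
  exact hirr a (Cycle.chain_iff_pairwise.1 h a (by simp) a (by simp))

lemma sec_step_left_unique (h : IsSector p P q Q) {a b c : Crossing}
    (h1 : Step (secWidth p P q Q) (secOffset p P q Q) a c)
    (h2 : Step (secWidth p P q Q) (secOffset p P q Q) b c) : a = b := by
  rcases step_cases h h1 with ⟨h3, h4, h5, h6⟩ | ⟨h3, h4, h5, h6⟩ <;>
    rcases step_cases h h2 with ⟨h7, h8, h9, h10⟩ | ⟨h7, h8, h9, h10⟩
  · have e : a.1 = b.1 := place_injective (by omega)
    rw [e] at h6
    exact Prod.ext e (by linarith)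
  · linarith
  · linarith
  · have e : a.1 = b.1 := place_injective (by omega)
    rw [e] at h6
    exact Prod.ext e (by linarith)

/-- Without a turn the place would be strictly monotone all the way around a cycle. -/
lemma exists_isTurn (h : IsSector p P q Q) {l : List Crossing}
    (hl : IsOrbitCycle (secWidth p P q Q) (secOffset p P q Q) l) :
    ∃ a ∈ l, IsTurn (secWidth p P (-q) (-Q)) a := by
  by_contra! hc
  have hout : ∀ a ∈ l, secWidth p P (-q) (-Q) a.1 ≠ twist a.1 * a.2 := by
    intro a ha
    obtain ⟨i, hi, rfl⟩ := List.getElem_of_mem ha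
    rcases step_cases h ((cycle_chain_iff_getElem hl.ne_nil).1 hl.chain i hi) with
      ⟨-, h2, -⟩ | ⟨-, h2, -⟩
    · exact h2.ne
    · exact h2.ne'
  let up : Crossing → Prop := fun a => secWidth p P (-q) (-Q) a.1 < twist a.1 * a.2
  refine not_cycle_chain (r := fun a b => (up a → up b ∧ place a.1 < place b.1) ∧
    (¬ up a → ¬ up b ∧ place b.1 < place a.1)) ?_ ?_ hl.ne_nil
    (cycle_chain_imp_of_mem hl.chain ?_)
  · rintro a b c ⟨h1, h2⟩ ⟨h3, h4⟩
    exact ⟨fun h => ⟨(h3 (h1 h).1).1, (h1 h).2.trans (h3 (h1 h).1).2⟩,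
      fun h => ⟨(h4 (h2 h).1).1, (h4 (h2 h).1).2.trans (h2 h).2⟩⟩
  · rintro a ⟨h1, h2⟩
    by_cases hu : up a
    · exact lt_irrefl _ (h1 hu).2
    · exact lt_irrefl _ (h2 hu).2
  · intro a _ b hb hs
    have hnb := hc b hb
    rw [IsTurn, ← abs_twist_mul b.1] at hnb
    rcases step_cases h hs with ⟨h1, h2, h3, h4⟩ | ⟨h1, h2, h3, h4⟩
    · refine ⟨fun _ => ⟨?_, by omega⟩, fun hu => absurd h2 hu⟩
      by_contra hu
      refine hnb (lt_of_lt_of_le (abs_lt.2 ⟨by linarith, ?_⟩) (le_abs_self _))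
      exact lt_of_le_of_ne (not_lt.1 hu) (hout b hb).symm
    · refine ⟨fun hu => absurd hu (not_lt.2 h2.le), fun _ => ⟨fun hu => ?_, by omega⟩⟩
      simp only [up] at hu
      exact hnb (lt_of_lt_of_le (abs_lt.2 ⟨by linarith, h3⟩) (neg_le_abs _))

/-- Side 3 is the middle of the path. A walk avoiding it oscillates between the sides 1, 4 or
between 2, 5, and each step then moves the coordinate by a fixed nonzero amount, `P` or `-Q`, so it
cannot close up. -/
lemma exists_fst_eq_three (h : IsSector p P q Q) {l : List Crossing}
    (hl : IsOrbitCycle (secWidth p P q Q) (secOffset p P q Q) l) : ∃ a ∈ l, a.1 = 3 := by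
  by_contra! hc
  -- The sign makes both drifts, `P` on the lower places and `-Q` on the upper ones, increasing.
  let f : Crossing → ℝ := fun a => if place a.1 ≤ 1 then a.2 else -a.2
  refine not_cycle_chain (r := fun a b => f a < f b) (fun _ _ _ => lt_trans)
    (fun _ => lt_irrefl _) hl.ne_nil (cycle_chain_imp_of_mem hl.chain ?_)
  rintro ⟨s, y⟩ ha ⟨s', y'⟩ hb hs
  have ha3 := hc _ ha
  have hb3 := hc _ hb
  have hcases := step_cases h hs
  obtain ⟨h1, h2, h3, h4, h5, h6⟩ := h
  simp only [f]
  clear hs ha hb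
  dsimp only at *
  rcases zmod_five_cases s with rfl | rfl | rfl | rfl | rfl <;>
  rcases zmod_five_cases s' with rfl | rfl | rfl | rfl | rfl <;>
  simp only [place_zero, place_one, place_two, place_three, place_four, secOffset_zero,
    secOffset_one, secOffset_two, secOffset_three, secOffset_four] at * <;>
  norm_num at * <;> linarith

/-- The turning crossings of a cycle form a cycle of the reflected direction, whose word is the
reduction of the word of the given cycle and determines it. -/
lemma exists_cycle_of_turns (h : IsSector p P q Q) {l : List Crossing}
    (hl : IsOrbitCycle (secWidth p P q Q) (secOffset p P q Q) l) :
    ∃ l', IsOrbitCycle (secWidth p P (-q) (-Q)) (secOffset p P (-q) (-Q)) l' ∧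
      reduce (l.map Prod.fst) ~r l'.map Prod.fst ∧
      l.map Prod.fst ~r fillCyclic (l'.map Prod.fst) := by
  classical
  obtain ⟨a, ha, hturn⟩ := exists_isTurn h hl
  -- The cycle is cut at a turn, so that runs are not broken.
  obtain ⟨l₁, l₂, rfl⟩ := List.append_of_mem ha
  have hrot : l₁ ++ a :: l₂ ~r a :: (l₂ ++ l₁) := List.isRotated_append
  have hl2 := hl.isRotated hrot
  obtain ⟨h1, h2⟩ := isChain_cyclic_turns h hturn hl2.chain
  have hfst : ∀ l : List Crossing, (l.map mirror).map Prod.fst = l.map Prod.fst := fun l => by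
    rw [List.map_map]
    rfl
  refine ⟨(turns (secWidth p P (-q) (-Q)) (a :: (l₂ ++ l₁))).map mirror, ⟨?_, ?_, ?_⟩, ?_, ?_⟩
  · rw [turns_cons_of_isTurn hturn]
    simp
  · exact (hl2.nodup.filter _).map mirror_injective
  · rw [turns_cons_of_isTurn hturn] at h1 ⊢
    rw [List.map_cons, Cycle.chain_coe_cons]
    simpa using h1
  · rw [hfst]
    refine (reduce_isRotated (hrot.map _)).trans ?_
    rw [reduce_map_fst (P := fun a => decide (IsTurn (secWidth p P (-q) (-Q)) a)) hl2.chain]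
    · exact List.IsRotated.refl _
    · intro a b c hab hbc
      rw [decide_eq_true_iff]
      exact sandwiched_iff_isTurn h hab hbc
  · rw [hfst, h2]
    exact hrot.map _

/-- Every cycle of the reflected direction arises from a cycle of the given direction. -/
lemma exists_cycle_of_fill (h : IsSector p P q Q) {l' : List Crossing}
    (hl : IsOrbitCycle (secWidth p P (-q) (-Q)) (secOffset p P (-q) (-Q)) l') :
    ∃ l, IsOrbitCycle (secWidth p P q Q) (secOffset p P q Q) l ∧
      l.map Prod.fst = fillCyclic (l'.map Prod.fst) ∧
      reduce (l.map Prod.fst) = l'.map Prod.fst := by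
  classical
  obtain ⟨m, rfl⟩ : ∃ m : List Crossing, l' = m.map mirror := by
    refine ⟨l'.map mirror, ?_⟩
    rw [List.map_map]
    refine (List.map_id l').symm.trans (List.map_congr_left fun a _ => ?_)
    simp [mirror]
  have hfst : ∀ l : List Crossing, (l.map mirror).map Prod.fst = l.map Prod.fst := fun l => by
    rw [List.map_map]
    rfl
  obtain ⟨hne, hnd, hch⟩ := hl
  cases m with
  | nil => simp at hne
  | cons a m =>
    rw [List.map_cons, Cycle.chain_coe_cons] at hch
    obtain ⟨M, h1, h2, h3⟩ := exists_isChain_fill h m a a (by simpa using hch)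
    refine ⟨a :: M, ⟨by simp, ?_, h1⟩, ?_, ?_⟩
    · have h4 : List.IsChain (Step (secWidth p P q Q) (secOffset p P q Q)) (a :: M) :=
        (List.isChain_append (l₁ := a :: M) (l₂ := [a])).1 h1 |>.1
      refine nodup_of_isChain (r := Step (secWidth p P q Q) (secOffset p P q Q))
        (fun _ _ _ => sec_step_left_unique h) h4 fun hmem => ?_
      -- A second occurrence of the initial crossing would again be a turn, contradicting the
      -- distinctness of the turns in the reflected cycle.
      have h5 : IsTurn (secWidth p P (-q) (-Q)) a := by
        have : a ∈ turns (secWidth p P (-q) (-Q)) (a :: M) := by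
          rw [h2]
          simp
        simpa using (List.mem_filter.1 this).2
      rw [turns_cons_of_isTurn h5, List.cons.injEq] at h2
      have h6 : a ∈ m := by
        rw [← h2.2]
        exact List.mem_filter.2 ⟨hmem, by simpa using h5⟩
      have h7 := hnd.of_map mirror
      exact (List.nodup_cons.1 h7).1 h6
    · rw [hfst, h3]
      simp [fillCyclic]
    · rw [hfst, ← h2]
      refine reduce_map_fst (P := fun a => decide (IsTurn (secWidth p P (-q) (-Q)) a))
        (r := Step (secWidth p P q Q) (secOffset p P q Q)) h1 ?_
      intro a b c hab hbc
      rw [decide_eq_true_iff]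
      exact sandwiched_iff_isTurn h hab hbc

end cycles

/-! ## Directions in coordinates -/

/-- The direction with the coordinates `p`, `-q` with respect to the directions of the sides `1`
and `5`. -/
def dir (p q : ℝ) : ℂ := p * (Complex.I * outer 1) - q * (Complex.I * outer 0)

lemma width_dir (p q : ℝ) (s : ZMod 5) :
    width (dir p q) s = secWidth (half ^ 2 * p) (half ^ 2 * (2 * inr * p)) (half ^ 2 * q)
      (half ^ 2 * (2 * inr * q)) s := by
  have h := four_inr_sq
  have h' := inr_sq_add_half_sq
  rcases zmod_five_cases s with rfl | rfl | rfl | rfl | rfl <;>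
    simp only [secWidth_zero, secWidth_one, secWidth_two, secWidth_three, secWidth_four] <;>
    simp only [width, ip, dir, outer_zero, outer_one, outer_two, outer_three, outer_four] <;>
    simp
  · ring
  · linear_combination (0 : ℝ) * h
  · linear_combination (-half ^ 2 * p / 2) * h
  · linear_combination (half ^ 2 * p / 2) * h
  · linear_combination 0 * h

/-- The excess `inr * (q - p)` does not depend on the side; only differences of offsets matter for
steps. -/
lemma offset_dir (p q : ℝ) (s : ZMod 5) :
    offset (dir p q) s = secOffset (half ^ 2 * p) (half ^ 2 * (2 * inr * p)) (half ^ 2 * q)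
      (half ^ 2 * (2 * inr * q)) s + inr * (q - p) := by
  have h := four_inr_sq
  have h' := inr_sq_add_half_sq
  rcases zmod_five_cases s with rfl | rfl | rfl | rfl | rfl <;>
    simp only [secOffset_zero, secOffset_one, secOffset_two, secOffset_three, secOffset_four] <;>
    simp only [offset, det, dir, outer_zero, outer_one, outer_two, outer_three, outer_four] <;>
    simp
  · linear_combination (p * (inr + 1)) * h - ((4 * inr + 1) * p) * h'
  · linear_combination (-(inr + 1) * q) * h + ((4 * inr + 1) * q - inr * p) * h'
  · linear_combination ((-inr ^ 2 / 2 + inr + 1) * p - inr / 2 * q) * h +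
      ((2 * inr ^ 2 - 4 * inr - 1) * p + 2 * inr * q) * h'
  · linear_combination ((inr ^ 2 / 2 + inr) * p - inr / 2 * q) * h +
      ((-2 * inr ^ 2 - 2 * inr) * p + 2 * inr * q) * h'
  · linear_combination (-(inr + 1) * q) * h + ((4 * inr + 1) * q - inr * p) * h'

lemma step_add_const (A B : ZMod 5 → ℝ) (C : ℝ) : Step A (fun s => B s + C) = Step A B := by
  funext a b
  simp only [Step, ← add_assoc, add_left_inj, ← sub_sub, sub_left_inj]

/-- The half widths of the sides for the direction `dir p q`. -/
def dirWidth (p q : ℝ) : ZMod 5 → ℝ :=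
  secWidth (half ^ 2 * p) (half ^ 2 * (2 * inr * p)) (half ^ 2 * q) (half ^ 2 * (2 * inr * q))

/-- The offsets of the sides, up to a constant, for the direction `dir p q`. -/
def dirOffset (p q : ℝ) : ZMod 5 → ℝ :=
  secOffset (half ^ 2 * p) (half ^ 2 * (2 * inr * p)) (half ^ 2 * q) (half ^ 2 * (2 * inr * q))

lemma step_dir (p q : ℝ) :
    Step (width (dir p q)) (offset (dir p q)) = Step (dirWidth p q) (dirOffset p q) := by
  rw [show width (dir p q) = dirWidth p q from funext (width_dir p q),
    show offset (dir p q) = _ from funext (offset_dir p q), step_add_const]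
  rfl

lemma isOrbit_dir_iff (p q : ℝ) (w : List (ZMod 5)) :
    IsOrbit (dir p q) w ↔
      ∃ l, IsOrbitCycle (dirWidth p q) (dirOffset p q) l ∧ w ~r l.map Prod.fst := by
  have h := step_dir p q
  constructor
  · rintro ⟨l, ⟨h1, h2, h3⟩, hw⟩
    exact ⟨l, ⟨h1, h2, h ▸ h3⟩, hw⟩
  · rintro ⟨l, ⟨h1, h2, h3⟩, hw⟩
    exact ⟨l, ⟨h1, h2, h ▸ h3⟩, hw⟩

lemma isSector_of_pos {p q : ℝ} (hp : 0 < p) (hq : 0 < q) :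
    IsSector (half ^ 2 * p) (half ^ 2 * (2 * inr * p)) (half ^ 2 * q)
      (half ^ 2 * (2 * inr * q)) := by
  have hh : 0 < half ^ 2 := pow_pos half_pos 2
  have h1 := inr_gt
  have h2 : inr < 1 := by nlinarith [four_inr_sq]
  have hp' := mul_pos hh hp
  have hq' := mul_pos hh hq
  exact ⟨hp', by nlinarith, by nlinarith, hq', by nlinarith, by nlinarith⟩

lemma dirWidth_neg (p q : ℝ) : dirWidth p (-q) = secWidth (half ^ 2 * p) (half ^ 2 * (2 * inr * p))
    (-(half ^ 2 * q)) (-(half ^ 2 * (2 * inr * q))) := by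
  simp only [dirWidth, mul_neg]

lemma dirOffset_neg (p q : ℝ) : dirOffset p (-q) = secOffset (half ^ 2 * p)
    (half ^ 2 * (2 * inr * p)) (-(half ^ 2 * q)) (-(half ^ 2 * (2 * inr * q))) := by
  simp only [dirOffset, mul_neg]

/-! ## Pairs of orbits -/

/-- The sign of the crossings of a side. -/
def sgn (v : ℂ) (s : ZMod 5) : ℤ := SignType.sign (width v s)

/-- The words `S` and `L` are the two symbolic orbits of the direction `v`, and their vectors of
signed symbol counts are related by the multiplication by the golden ratio. -/
structure IsPair (v : ℂ) (S L : List (ZMod 5)) : Prop where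
  isOrbit_iff : ∀ w, IsOrbit v w ↔ w ~r S ∨ w ~r L
  count_eq : ∀ s, sgn v s * L.count s =
    -(sgn v (s + 1) * S.count (s + 1) + sgn v (s - 1) * S.count (s - 1))

lemma map_add_neg_map_add (k : ZMod 5) (w : List (ZMod 5)) :
    (w.map (· + k)).map (· + -k) = w := by
  simp [Function.comp_def]

lemma isRotated_map_add_iff (k : ZMod 5) (w w' : List (ZMod 5)) :
    w.map (· + -k) ~r w' ↔ w ~r w'.map (· + k) := by
  constructor
  · intro h
    have := h.map (· + k)
    simpa [Function.comp_def] using this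
  · intro h
    have := h.map (· + -k)
    rwa [map_add_neg_map_add] at this

lemma count_map_add (k s : ZMod 5) (w : List (ZMod 5)) :
    (w.map (· + k)).count s = w.count (s - k) := by
  have := List.count_map_of_injective w (· + k) (add_left_injective k) (s - k)
  simpa using this

lemma sgn_outer_mul (k s : ZMod 5) (v : ℂ) : sgn (outer k * v) s = sgn v (s - k) := by
  have := width_outer_mul k (s - k) v
  rw [sub_add_cancel] at this
  rw [sgn, this, sgn]

lemma IsPair.outer_mul {v : ℂ} {S L : List (ZMod 5)} (h : IsPair v S L) (k : ZMod 5) :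
    IsPair (outer k * v) (S.map (· + k)) (L.map (· + k)) where
  isOrbit_iff w := by
    rw [← isRotated_map_add_iff, ← isRotated_map_add_iff, ← h.isOrbit_iff]
    constructor
    · intro hw
      have := hw.outer_mul (-k)
      rwa [← mul_assoc, ← outer_add, neg_add_cancel, outer_zero, one_mul] at this
    · intro hw
      have := hw.outer_mul k
      simpa [Function.comp_def] using this
  count_eq s := by
    have := h.count_eq (s - k)
    simp only [sgn_outer_mul, count_map_add]
    rw [show s + 1 - k = s - k + 1 by ring, show s - 1 - k = s - k - 1 by ring]
    exact this

lemma IsPair.mul {v : ℂ} {S L : List (ZMod 5)} (h : IsPair v S L) {c : ℝ} (hc : c ≠ 0) :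
    IsPair (c * v) S L where
  isOrbit_iff w := by
    rw [← h.isOrbit_iff]
    constructor
    · intro hw
      have := hw.mul (inv_ne_zero hc)
      push_cast at this
      rwa [inv_mul_cancel_left₀ (by exact_mod_cast hc)] at this
    · intro hw
      exact hw.mul hc
  count_eq s := by
    have := h.count_eq s
    have e : ∀ s, sgn (c * v) s = SignType.sign c * sgn v s := by
      intro s
      rw [sgn, width_mul, sign_mul, SignType.coe_mul, sgn]
    simp only [e, mul_assoc, this]
    ring

/-! ## Counting symbols -/

lemma sum_map_eq_sum_count (w : List (ZMod 5)) (f : ZMod 5 → ℤ) :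
    (w.map f).sum = w.count 0 * f 0 + w.count 1 * f 1 + w.count 2 * f 2 + w.count 3 * f 3 +
      w.count 4 * f 4 := by
  induction w with
  | nil => simp
  | cons a w ih =>
    rw [List.map_cons, List.sum_cons, ih]
    rcases zmod_five_cases a with rfl | rfl | rfl | rfl | rfl <;>
      simp +decide <;> ring

lemma length_eq_sum_count (w : List (ZMod 5)) :
    w.length = w.count 0 + w.count 1 + w.count 2 + w.count 3 + w.count 4 := by
  have := sum_map_eq_sum_count w fun _ => 1
  simp at this
  exact_mod_cast this

/-! ### Symbol counts of a filled word -/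

lemma count_run_up {s s' : ZMod 5} (h : place s < place s') (x : ZMod 5) :
    ((run s s').count x : ℤ) =
      (if place s ≤ place x then 1 else 0) - (if place s' ≤ place x then 1 else 0) := by
  revert h
  revert s s' x
  decide

lemma count_run_down {s s' : ZMod 5} (h : place s' < place s) (x : ZMod 5) :
    ((run s s').count x : ℤ) =
      (if place s' < place x then 1 else 0) - (if place s < place x then 1 else 0) := by
  revert h
  revert s s' x
  decide

/-- The alternation of the bottom turns (`ε = -1`) and the top turns (`ε = 1`). -/
def Alternates (ε : ZMod 5 → ℤ) (s s' : ZMod 5) : Prop :=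
  ε s = -1 ∧ ε s' = 1 ∧ place s < place s' ∨ ε s = 1 ∧ ε s' = -1 ∧ place s' < place s

lemma fill_count {ε : ZMod 5 → ℤ} {f g : ZMod 5 → ℤ} {x : ZMod 5}
    (h : ∀ s s', Alternates ε s s' → ((run s s').count x : ℤ) = f s + g s') (l : List (ZMod 5)) :
    ∀ a b, List.IsChain (Alternates ε) (a :: (l ++ [b])) →
      ((fill (a :: (l ++ [b]))).count x : ℤ) =
        ((a :: l).map f).sum + ((l ++ [b]).map g).sum := by
  induction l with
  | nil =>
    intro a b hch
    simp only [List.nil_append, List.isChain_pair] at hch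
    simp [fill_cons_cons, fill_singleton, h a b hch]
  | cons c l ih =>
    intro a b hch
    rw [List.cons_append, List.isChain_cons_cons] at hch
    have := ih c b hch.2
    rw [List.cons_append, fill_cons_cons, List.count_append]
    push_cast
    rw [this, h a c hch.1]
    simp only [List.map_cons, List.sum_cons]
    ring

/-- The count of `x` in a run is a difference of indicators of its two ends. Every turn ends one run
and starts the next, contributing one weak and one strict comparison with the place of `x`, positive
at the bottom and negative at the top. -/
lemma fillCyclic_count {ε : ZMod 5 → ℤ} {w : List (ZMod 5)}
    (hw : Cycle.Chain (Alternates ε) (w : Cycle (ZMod 5))) (x : ZMod 5) :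
    ((fillCyclic w).count x : ℤ) = (w.map fun s => -ε s * ((if place s ≤ place x then 1 else 0) +
      (if place s < place x then 1 else 0))).sum := by
  cases w with
  | nil => rfl
  | cons a l =>
    rw [Cycle.chain_coe_cons] at hw
    rw [fillCyclic, fill_count (f := fun s => if ε s = -1 then (if place s ≤ place x then 1 else 0)
        else -ε s * (if place s < place x then 1 else 0))
      (g := fun s => if ε s = -1 then (if place s < place x then 1 else 0) else
        -ε s * (if place s ≤ place x then 1 else 0)) ?_ l a a hw]
    · have e : ∀ g : ZMod 5 → ℤ, ((l ++ [a]).map g).sum = ((a :: l).map g).sum := fun g => by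
        simp [add_comm]
      rw [e, ← List.sum_map_add]
      congr 1
      refine List.map_congr_left fun s _ => ?_
      by_cases hs : ε s = -1
      · simp [hs]
      · simp only [hs, if_false]
        ring
    · rintro s s' (⟨h1, h2, h3⟩ | ⟨h1, h2, h3⟩)
      · simp only [count_run_up h3, h1, h2]
        split_ifs <;> norm_num at *
      · simp only [count_run_down h3, h1, h2]
        split_ifs <;> norm_num at *

lemma sum_map_eq_zero {ε : ZMod 5 → ℤ} {w : List (ZMod 5)}
    (hw : Cycle.Chain (Alternates ε) (w : Cycle (ZMod 5))) : (w.map ε).sum = 0 := by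
  have key : ∀ (l : List (ZMod 5)) a b, List.IsChain (Alternates ε) (a :: (l ++ [b])) →
      ((a :: l).map ε).sum + ((l ++ [b]).map ε).sum = 0 := by
    have h : ∀ s s', Alternates ε s s' → ε s + ε s' = 0 := by
      rintro s s' (⟨h1, h2, -⟩ | ⟨h1, h2, -⟩) <;> simp [h1, h2]
    intro l
    induction l with
    | nil =>
      intro a b hch
      simp only [List.nil_append, List.isChain_pair] at hch
      simpa using h a b hch
    | cons c l ih =>
      intro a b hch
      rw [List.cons_append, List.isChain_cons_cons] at hch
      have h1 := ih c b hch.2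
      have h2 := h a c hch.1
      simp only [List.map_cons, List.sum_cons, List.cons_append] at h1 ⊢
      linarith
  cases w with
  | nil => rfl
  | cons a l =>
    rw [Cycle.chain_coe_cons] at hw
    have := key l a a hw
    simp at this ⊢
    linarith

lemma alternates_of_step {p P q Q : ℝ} (h : IsSector p P q Q) {a b : Crossing}
    (hs : Step (secWidth p P (-q) (-Q)) (secOffset p P (-q) (-Q)) a b) :
    Alternates (fun s => SignType.sign (secWidth p P (-q) (-Q) s)) a.1 b.1 := by
  obtain ⟨ha, hb, ⟨h1, h2, h3⟩ | ⟨h1, h2, h3⟩⟩ := hs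
  · rw [abs_of_neg h1, abs_lt] at ha
    rw [abs_of_pos h2, abs_lt] at hb
    refine Or.inl ⟨by simp [sign_neg h1], by simp [sign_pos h2], ?_⟩
    exact place_lt_place (y := -a.2) (y' := -b.2) h h1 h2 (by linarith) (by linarith) (by linarith)
      (by linarith) (by linarith)
  · rw [abs_of_pos h1, abs_lt] at ha
    rw [abs_of_neg h2, abs_lt] at hb
    refine Or.inr ⟨by simp [sign_pos h1], by simp [sign_neg h2], ?_⟩
    exact place_lt_place (y := b.2) (y' := a.2) h h2 h1 (by linarith) (by linarith) (by linarith)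
      (by linarith) (by linarith)

/-- The symbol counts of the filled word in terms of the signed symbol counts of the given one. -/
lemma counts_of_chain {ε : ZMod 5 → ℤ} {w : List (ZMod 5)}
    (hw : Cycle.Chain (Alternates ε) (w : Cycle (ZMod 5))) :
    ε 0 * w.count 0 + ε 1 * w.count 1 + ε 2 * w.count 2 + ε 3 * w.count 3 + ε 4 * w.count 4 = 0 ∧
    ((fillCyclic w).count 1 : ℤ) = -(ε 1 * w.count 1) ∧
    ((fillCyclic w).count 4 : ℤ) = -(2 * (ε 1 * w.count 1) + ε 4 * w.count 4) ∧
    ((fillCyclic w).count 3 : ℤ) =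
      -(2 * (ε 1 * w.count 1) + 2 * (ε 4 * w.count 4) + ε 3 * w.count 3) ∧
    ((fillCyclic w).count 2 : ℤ) = -(2 * (ε 1 * w.count 1) + 2 * (ε 4 * w.count 4) +
      2 * (ε 3 * w.count 3) + ε 2 * w.count 2) ∧
    ((fillCyclic w).count 0 : ℤ) = -(2 * (ε 1 * w.count 1) + 2 * (ε 4 * w.count 4) +
      2 * (ε 3 * w.count 3) + 2 * (ε 2 * w.count 2) + ε 0 * w.count 0) := by
  have h0 := sum_map_eq_zero hw
  rw [sum_map_eq_sum_count] at h0
  refine ⟨by linarith, ?_, ?_, ?_, ?_, ?_⟩ <;>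
    rw [fillCyclic_count hw, sum_map_eq_sum_count, place_zero, place_one, place_two, place_three,
      place_four] <;> norm_num <;> ring

lemma sgn_dir (p q : ℝ) (s : ZMod 5) : sgn (dir p q) s = SignType.sign (dirWidth p q s) := by
  rw [sgn, width_dir, dirWidth]

/-- The symbolic orbits of a direction in the sector and those of the reflected direction. -/
lemma isPair_dir {p q : ℝ} (hp : 0 < p) (hq : 0 < q) {S L : List (ZMod 5)}
    (h : IsPair (dir p (-q)) S L) :
    IsPair (dir p q) (fillCyclic S) (fillCyclic L) ∧
      (fillCyclic S).length < (fillCyclic L).length ∧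
      reduce (fillCyclic S) ~r S ∧ reduce (fillCyclic L) ~r L := by
  have hsec := isSector_of_pos hp hq
  -- The cycle is rotated first, so that its word is literally `w` and not only a rotation of it.
  have hfill : ∀ w, IsOrbit (dir p (-q)) w →
      ∃ l l', IsOrbitCycle (dirWidth p q) (dirOffset p q) l ∧
        IsOrbitCycle (dirWidth p (-q)) (dirOffset p (-q)) l' ∧ l'.map Prod.fst = w ∧
        l.map Prod.fst = fillCyclic w ∧ reduce (l.map Prod.fst) = w := by
    intro w hw
    obtain ⟨l', hl', hwl⟩ := (isOrbit_dir_iff _ _ _).1 hw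
    obtain ⟨k, hk⟩ := hwl.symm
    rw [← List.map_rotate] at hk
    have hl'' := hl'.isRotated ⟨k, rfl⟩
    rw [dirWidth_neg, dirOffset_neg] at hl''
    obtain ⟨l, h1, h2, h3⟩ := exists_cycle_of_fill hsec hl''
    rw [hk] at h2 h3
    rw [← dirWidth_neg, ← dirOffset_neg] at hl''
    exact ⟨l, _, h1, hl'', hk, h2, h3⟩
  have hS := (h.isOrbit_iff S).2 (Or.inl (List.IsRotated.refl _))
  have hL := (h.isOrbit_iff L).2 (Or.inr (List.IsRotated.refl _))
  obtain ⟨lS, lS', hS1, hS2, hS3, hS4, hS5⟩ := hfill S hS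
  obtain ⟨lL, lL', hL1, hL2, hL3, hL4, hL5⟩ := hfill L hL
  have halt : ∀ {l : List Crossing} {w : List (ZMod 5)},
      IsOrbitCycle (dirWidth p (-q)) (dirOffset p (-q)) l → l.map Prod.fst = w →
      Cycle.Chain (Alternates (sgn (dir p (-q)))) (w : Cycle (ZMod 5)) := by
    rintro l w hl rfl
    rw [← Cycle.map_coe, Cycle.chain_map]
    refine hl.chain.imp fun a b hab => ?_
    have e : sgn (dir p (-q)) = fun s => (SignType.sign (dirWidth p (-q) s) : ℤ) :=
      funext (sgn_dir p (-q))
    rw [dirWidth_neg, dirOffset_neg] at hab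
    rw [e, dirWidth_neg]
    exact alternates_of_step hsec hab
  have cS := counts_of_chain (halt hS2 hS3)
  have cL := counts_of_chain (halt hL2 hL3)
  have hpos := hsec
  obtain ⟨p1, p2, p3, p4, p5, p6⟩ := hpos
  have s0 : sgn (dir p q) 0 = 1 := by
    rw [sgn_dir, sign_pos (by simpa only [dirWidth, secWidth_zero] using p1)]
    rfl
  have s1 : sgn (dir p q) 1 = 1 := by
    rw [sgn_dir, sign_pos (by simpa only [dirWidth, secWidth_one] using p4)]
    rfl
  have s2 : sgn (dir p q) 2 = -1 := by
    rw [sgn_dir, sign_neg (by simp only [dirWidth, secWidth_two]; linarith)]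
    rfl
  have s3 : sgn (dir p q) 3 = 1 := by
    rw [sgn_dir, sign_pos (by simp only [dirWidth, secWidth_three]; linarith)]
    rfl
  have s4 : sgn (dir p q) 4 = -1 := by
    rw [sgn_dir, sign_neg (by simp only [dirWidth, secWidth_four]; linarith)]
    rfl
  have h0 := h.count_eq 0
  have h1 := h.count_eq 1
  have h2 := h.count_eq 2
  have h3 := h.count_eq 3
  have h4 := h.count_eq 4
  simp only [show (0 : ZMod 5) + 1 = 1 by decide, show (0 : ZMod 5) - 1 = 4 by decide,
    show (1 : ZMod 5) + 1 = 2 by decide, show (1 : ZMod 5) - 1 = 0 by decide,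
    show (2 : ZMod 5) + 1 = 3 by decide, show (2 : ZMod 5) - 1 = 1 by decide,
    show (3 : ZMod 5) + 1 = 4 by decide, show (3 : ZMod 5) - 1 = 2 by decide,
    show (4 : ZMod 5) + 1 = 0 by decide, show (4 : ZMod 5) - 1 = 3 by decide] at h0 h1 h2 h3 h4
  refine ⟨⟨?_, ?_⟩, ?_, ?_, ?_⟩
  · intro w
    constructor
    · intro hw
      obtain ⟨l, hl, hwl⟩ := (isOrbit_dir_iff _ _ _).1 hw
      obtain ⟨l', h5, -, h6⟩ := exists_cycle_of_turns hsec hl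
      have h7 : IsOrbit (dir p (-q)) (l'.map Prod.fst) := by
        rw [isOrbit_dir_iff, dirWidth_neg, dirOffset_neg]
        exact ⟨l', h5, List.IsRotated.refl _⟩
      rcases (h.isOrbit_iff _).1 h7 with h8 | h8
      · exact Or.inl (hwl.trans (h6.trans (fillCyclic_isRotated h8)))
      · exact Or.inr (hwl.trans (h6.trans (fillCyclic_isRotated h8)))
    · rw [isOrbit_dir_iff]
      rintro (hw | hw)
      · exact ⟨lS, hS1, hS4 ▸ hw⟩
      · exact ⟨lL, hL1, hL4 ▸ hw⟩
  · intro s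
    rcases zmod_five_cases s with rfl | rfl | rfl | rfl | rfl <;>
      simp only [show (0 : ZMod 5) + 1 = 1 by decide, show (0 : ZMod 5) - 1 = 4 by decide,
        show (1 : ZMod 5) + 1 = 2 by decide, show (1 : ZMod 5) - 1 = 0 by decide,
        show (2 : ZMod 5) + 1 = 3 by decide, show (2 : ZMod 5) - 1 = 1 by decide,
        show (3 : ZMod 5) + 1 = 4 by decide, show (3 : ZMod 5) - 1 = 2 by decide,
        show (4 : ZMod 5) + 1 = 0 by decide, show (4 : ZMod 5) - 1 = 3 by decide,
        s0, s1, s2, s3, s4] <;> linarith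
  -- By the count relation for the filled words, the difference of lengths equals the number of
  -- symbols 3 in the filled `S` plus those of 0 and 1 in the filled `L`. The first of these is
  -- positive.
  · have h5 : 0 < (fillCyclic S).count 3 := by
      obtain ⟨a, ha, ha3⟩ := exists_fst_eq_three hsec hS1
      rw [List.count_pos_iff, ← hS4, ← ha3]
      exact List.mem_map_of_mem ha
    have h6 := length_eq_sum_count (fillCyclic S)
    have h7 := length_eq_sum_count (fillCyclic L)
    zify at h5 h6 h7 ⊢
    linarith
  · rw [← hS4, hS5]
  · rw [← hL4, hL5]

/-! ## The directions of the sides -/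

/-- In the direction of the side `1`, trajectories alternate between the sides `5` and `2`, or
between the sides `3` and `4`. -/
lemma isPair_outer_one : IsPair (Complex.I * outer 1) [0, 2] [3, 4] := by
  have e : Complex.I * outer 1 = dir 1 0 := by simp [dir]
  have hh : 0 < half ^ 2 := pow_pos half_pos 2
  have hP : 0 < half ^ 2 * (2 * inr) := mul_pos hh (by linarith [inr_gt])
  have w0 : dirWidth 1 0 0 = half ^ 2 := by simp [dirWidth, secWidth_zero]
  have w1 : dirWidth 1 0 1 = 0 := by simp [dirWidth, secWidth_one]
  have w2 : dirWidth 1 0 2 = -half ^ 2 := by simp [dirWidth, secWidth_two]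
  have w3 : dirWidth 1 0 3 = half ^ 2 * (2 * inr) := by simp [dirWidth, secWidth_three]
  have w4 : dirWidth 1 0 4 = -(half ^ 2 * (2 * inr)) := by simp [dirWidth, secWidth_four]
  have o0 : dirOffset 1 0 0 = 2 * (half ^ 2 * (2 * inr)) + half ^ 2 := by
    simp [dirOffset, secOffset_zero]
  have o2 : dirOffset 1 0 2 = 2 * (half ^ 2 * (2 * inr)) + half ^ 2 := by
    simp [dirOffset, secOffset_two]
  have o3 : dirOffset 1 0 3 = half ^ 2 * (2 * inr) := by simp [dirOffset, secOffset_three]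
  have o4 : dirOffset 1 0 4 = half ^ 2 * (2 * inr) := by simp [dirOffset, secOffset_four]
  -- The offsets agree within each of the pairs 5, 2 and 3, 4, so the coordinate never changes and
  -- every cycle has two crossings.
  have hstep : ∀ a b, Step (dirWidth 1 0) (dirOffset 1 0) a b → b.2 = a.2 ∧
      (a.1 = 0 ∧ b.1 = 2 ∨ a.1 = 2 ∧ b.1 = 0 ∨ a.1 = 3 ∧ b.1 = 4 ∨ a.1 = 4 ∧ b.1 = 3) := by
    rintro ⟨s, y⟩ ⟨s', y'⟩ ⟨ha, hb, hs⟩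
    dsimp only at *
    have ha' := abs_lt.1 ha
    have hb' := abs_lt.1 hb
    rcases zmod_five_cases s with rfl | rfl | rfl | rfl | rfl <;>
    rcases zmod_five_cases s' with rfl | rfl | rfl | rfl | rfl <;>
    simp only [w0, w1, w2, w3, w4, o0, o2, o3, o4, abs_neg, abs_of_pos hh, abs_of_pos hP] at * <;>
    rcases hs with ⟨h1, h2, h3⟩ | ⟨h1, h2, h3⟩ <;>
    first
    | (exfalso; linarith)
    | exact ⟨by linarith, by decide⟩
  have hsym : ∀ s s', s = 0 ∧ s' = 2 ∨ s = 3 ∧ s' = 4 →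
      Step (dirWidth 1 0) (dirOffset 1 0) (s, 0) (s', 0) ∧
        Step (dirWidth 1 0) (dirOffset 1 0) (s', 0) (s, 0) := by
    rintro s s' (⟨rfl, rfl⟩ | ⟨rfl, rfl⟩) <;>
    simp only [Step, w0, w2, w3, w4, o0, o2, o3, o4, abs_neg, abs_of_pos hh, abs_of_pos hP,
      abs_zero, hh, hP, neg_lt_zero, and_true, or_true, true_or, and_self]
  have hcyc : ∀ s s', s = 0 ∧ s' = 2 ∨ s = 3 ∧ s' = 4 →
      IsOrbitCycle (dirWidth 1 0) (dirOffset 1 0) [(s, 0), (s', 0)] := by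
    intro s s' h
    refine ⟨by simp, ?_, ?_⟩
    · rcases h with ⟨rfl, rfl⟩ | ⟨rfl, rfl⟩ <;> simp +decide
    · rw [Cycle.chain_coe_cons]
      simpa using hsym s s' h
  refine ⟨fun w => ?_, ?_⟩
  · rw [e, isOrbit_dir_iff]
    constructor
    · rintro ⟨l, hl, hw⟩
      obtain ⟨hne, hnd, hch⟩ := hl
      rcases l with - | ⟨a, - | ⟨b, l⟩⟩
      · exact absurd rfl hne
      · rw [Cycle.chain_coe_cons, List.nil_append, List.isChain_pair] at hch
        have := (hstep _ _ hch).2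
        rcases this with ⟨h1, h2⟩ | ⟨h1, h2⟩ | ⟨h1, h2⟩ | ⟨h1, h2⟩ <;> rw [h1] at h2 <;>
          exact absurd h2 (by decide)
      · rw [Cycle.chain_coe_cons, List.cons_append, List.isChain_cons_cons] at hch
        have h1 := hstep _ _ hch.1
        cases l with
        | nil =>
          simp only [List.map_cons, List.map_nil] at hw
          rcases h1.2 with ⟨h2, h3⟩ | ⟨h2, h3⟩ | ⟨h2, h3⟩ | ⟨h2, h3⟩ <;> rw [h2, h3] at hw
          · exact Or.inl hw
          · exact Or.inl (hw.trans ⟨1, rfl⟩)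
          · exact Or.inr hw
          · exact Or.inr (hw.trans ⟨1, rfl⟩)
        | cons c l =>
          rw [List.cons_append, List.isChain_cons_cons] at hch
          have h2 := hstep _ _ hch.2.1
          have h3 : c.1 = a.1 := by
            have h4 := h1.2
            have h5 := h2.2
            clear hch h1 h2 hnd hw
            revert h4 h5
            generalize a.1 = s, b.1 = s', c.1 = s''
            clear * -
            revert s s' s''
            decide
          have h4 : a = c := Prod.ext h3.symm (h2.1.trans h1.1).symm
          simp [h4] at hnd
    · rintro (hw | hw)
      · exact ⟨_, hcyc 0 2 (by simp), hw⟩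
      · exact ⟨_, hcyc 3 4 (by simp), hw⟩
  · have s0 : sgn (dir 1 0) 0 = 1 := by rw [sgn_dir, w0, sign_pos hh]; rfl
    have s2 : sgn (dir 1 0) 2 = -1 := by rw [sgn_dir, w2, sign_neg (by linarith)]; rfl
    have s3 : sgn (dir 1 0) 3 = 1 := by rw [sgn_dir, w3, sign_pos hP]; rfl
    have s4 : sgn (dir 1 0) 4 = -1 := by rw [sgn_dir, w4, sign_neg (by linarith)]; rfl
    have s1 : sgn (dir 1 0) 1 = 0 := by rw [sgn_dir, w1, sign_zero]; rfl
    intro s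
    rw [e]
    rcases zmod_five_cases s with rfl | rfl | rfl | rfl | rfl <;>
      simp only [show (0 : ZMod 5) + 1 = 1 by decide, show (0 : ZMod 5) - 1 = 4 by decide,
        show (1 : ZMod 5) + 1 = 2 by decide, show (1 : ZMod 5) - 1 = 0 by decide,
        show (2 : ZMod 5) + 1 = 3 by decide, show (2 : ZMod 5) - 1 = 1 by decide,
        show (3 : ZMod 5) + 1 = 4 by decide, show (3 : ZMod 5) - 1 = 2 by decide,
        show (4 : ZMod 5) + 1 = 0 by decide, show (4 : ZMod 5) - 1 = 3 by decide,
        s0, s1, s2, s3, s4] <;> simp +decide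

/-! ## Reflections and pentagons -/

/-- Two vectors span the same line. -/
def Proportional (x y : ℂ) : Prop := ∃ c : ℝ, c ≠ 0 ∧ x = c * y

lemma Proportional.trans {x y z : ℂ} (h : Proportional x y) (h' : Proportional y z) :
    Proportional x z := by
  obtain ⟨c, hc, rfl⟩ := h
  obtain ⟨d, hd, rfl⟩ := h'
  exact ⟨c * d, mul_ne_zero hc hd, by push_cast; ring⟩

lemma Proportional.reflect {a b x a' b' x' : ℂ} (ha : Proportional a a') (hb : Proportional b b')
    (hx : Proportional x x') : Proportional (reflect a b x) (reflect a' b' x') := by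
  obtain ⟨c, hc, rfl⟩ := ha
  obtain ⟨d, hd, rfl⟩ := hb
  obtain ⟨e, he, rfl⟩ := hx
  refine ⟨c * d * e, mul_ne_zero (mul_ne_zero hc hd) he, ?_⟩
  have h1 : det (e * x') (d * b') = e * d * det x' b' := by
    simp [det]
    ring
  have h2 : det (e * x') (c * a') = e * c * det x' a' := by
    simp [det]
    ring
  rw [DoublePentagon.reflect, DoublePentagon.reflect, h1, h2]
  push_cast
  ring

lemma reflect_comm (a b x : ℂ) : reflect a b x = reflect b a x := by
  simp only [reflect]
  ring

lemma reflect_mul (a b x : ℂ) (c : ℝ) : reflect a b (c * x) = c * reflect a b x := by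
  have h : ∀ y, det (c * x) y = c * det x y := fun y => by
    simp [det]
    ring
  simp only [reflect, h]
  push_cast
  ring

lemma det_reflect (a b x y : ℂ) :
    det (reflect a b x) (reflect a b y) = -(det a b) ^ 2 * det x y := by
  simp only [det, reflect, Complex.add_re, Complex.add_im, Complex.mul_re, Complex.mul_im,
    Complex.ofReal_re, Complex.ofReal_im]
  ring

/-- Conjugating a reflection by another one gives the reflection in the image geodesic; the scalar
comes from the determinant of `reflect a b`. -/
lemma reflect_reflect (a b x y z : ℂ) :
    reflect (reflect a b x) (reflect a b y) (reflect a b z) =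
      (-(det a b) ^ 2 : ℝ) * reflect a b (reflect x y z) := by
  have h : ∀ (s t : ℝ), reflect a b (s * x + t * y) = s * reflect a b x + t * reflect a b y := by
    intro s t
    have h' : ∀ w, det (s * x + t * y) w = s * det x w + t * det y w := fun w => by
      simp [det]
      ring
    simp only [reflect, h']
    push_cast
    ring
  nth_rewrite 1 [reflect]
  rw [det_reflect, det_reflect]
  nth_rewrite 4 [reflect]
  rw [h]
  push_cast
  ring

lemma det_outer_mul (k : ZMod 5) (x y : ℂ) : det (outer k * x) (outer k * y) = det x y := by
  have h := outer_re_sq_add_im_sq k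
  simp only [det, Complex.mul_re, Complex.mul_im]
  linear_combination (x.re * y.im - x.im * y.re) * h

lemma reflect_outer_mul (k : ZMod 5) (a b x : ℂ) :
    reflect (outer k * a) (outer k * b) (outer k * x) = outer k * reflect a b x := by
  simp only [reflect, det_outer_mul]
  ring

lemma pentagonZero_eq (m j : ZMod 5) : pentagonZero (j - m) = outer m * pentagonZero j := by
  rw [pentagonZero, pentagonZero, show 1 - (j - m) = m + (1 - j) by ring, outer_add]
  ring

lemma det_pentagonZero (j : ZMod 5) : det (pentagonZero j) (pentagonZero (j + 1)) = half := by
  have h1 := pentagonZero_eq (-j) 0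
  have h2 := pentagonZero_eq (-j) 1
  rw [show 0 - -j = j by ring] at h1
  rw [show 1 - -j = j + 1 by ring] at h2
  rw [h1, h2, det_outer_mul, pentagonZero, pentagonZero, sub_zero, sub_self, outer_zero, outer_one]
  simp [det]

/-- Adjacent vertices stay linearly independent, so the next reflections are nondegenerate. -/
lemma det_nextPentagon_ne_zero {p : ZMod 5 → ℂ} (hp : ∀ j, det (p j) (p (j + 1)) ≠ 0)
    (m j : ZMod 5) : det (nextPentagon p m j) (nextPentagon p m (j + 1)) ≠ 0 := by
  rw [nextPentagon, nextPentagon, det_reflect]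
  refine mul_ne_zero (neg_ne_zero.2 (pow_ne_zero _ (hp m))) ?_
  have h := hp (m - (j + 1))
  rw [show m - (j + 1) + 1 = m - j by ring] at h
  intro h0
  apply h
  simp only [det] at h0 ⊢
  linarith

lemma det_pentagon_ne_zero (n : ℕ → ℕ) (k : ℕ) :
    ∀ j, det (pentagon n k j) (pentagon n k (j + 1)) ≠ 0 := by
  induction k with
  | zero => exact det_nextPentagon_ne_zero (fun j => by rw [det_pentagonZero]; exact half_pos.ne') _
  | succ k ih => exact det_nextPentagon_ne_zero ih _

lemma α_succ (n : ℕ → ℕ) (k : ℕ) :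
    Proportional (α (k + 1) n) (pentagon n k (n (k + 1) : ZMod 5)) := by
  refine ⟨_, det_pentagon_ne_zero n k (n (k + 1)), ?_⟩
  rw [α, pentagon, nextPentagon, reflect, sub_zero]
  simp [det]
  ring_nf
  simp

lemma pentagon_zero_apply (n : ℕ → ℕ) (j : ZMod 5) :
    pentagon n 0 j = reflect (pentagonZero 0) (pentagonZero 1) (pentagonZero (0 - j)) := rfl

lemma pentagon_succ_apply (n : ℕ → ℕ) (k : ℕ) (j : ZMod 5) :
    pentagon n (k + 1) j = reflect (pentagon n k (n (k + 1))) (pentagon n k (n (k + 1) + 1))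
      (pentagon n k (n (k + 1) - j)) := rfl

lemma pentagon_congr {n n' : ℕ → ℕ} {k : ℕ} (h : ∀ i, 1 ≤ i → i ≤ k → n i = n' i) :
    pentagon n k = pentagon n' k := by
  induction k with
  | zero => rfl
  | succ k ih =>
    rw [pentagon, pentagon, ih fun i h1 h2 => h i h1 (by omega), h (k + 1) (by omega) le_rfl]

/-- The reflection that interchanges the pentagons of the generations `0` and `1`. -/
def flip (x : ℂ) : ℂ := reflect (pentagonZero 0) (pentagonZero 1) x

lemma flip_dir (p q : ℝ) : flip (dir p q) = half * dir p (-q) := by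
  have h := det_pentagonZero 0
  rw [zero_add, pentagonZero, pentagonZero, sub_zero, sub_self] at h
  rw [flip, reflect, dir, dir, pentagonZero, pentagonZero, sub_zero, sub_self]
  have h1 : ∀ a b : ℂ, det (p * a - q * b) b = p * det a b := fun a b => by
    simp [det]
    ring
  have h2 : ∀ a b : ℂ, det (p * a - q * b) a = q * det a b := fun a b => by
    simp [det]
    ring
  rw [h1, h2, h]
  push_cast
  ring

lemma reflect_flip (x y z : ℂ) :
    Proportional (reflect (flip x) (flip y) (flip z)) (flip (reflect x y z)) := by
  refine ⟨_, ?_, reflect_reflect _ _ x y z⟩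
  have := det_pentagonZero 0
  rw [zero_add] at this
  rw [this]
  exact neg_ne_zero.2 (pow_ne_zero _ half_pos.ne')

lemma Proportional.flip {x y : ℂ} (h : Proportional x y) :
    Proportional (DoublePentagon.flip x) (DoublePentagon.flip y) := by
  obtain ⟨c, hc, rfl⟩ := h
  exact ⟨c, hc, reflect_mul _ _ _ _⟩

/-- The reflection and a rotation take a pentagon of generation `k + 2` to one of generation
`k + 1`. -/
lemma pentagon_succ_proportional (n : ℕ → ℕ) (k : ℕ)
    (hn : ∀ i, 2 ≤ i → i ≤ k + 1 → n i ≤ 3) (j : ZMod 5) :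
    Proportional (pentagon n (k + 1) j)
      (flip (outer (n 1 + 1) * pentagon (fun i => 3 - n (i + 1)) k (4 - j))) := by
  induction k generalizing j with
  | zero =>
    -- The reflection exchanges the pentagons of the generations 0 and 1 and reverses the order of
    -- vertices.
    have e : ∀ i, pentagon n 0 i = flip (pentagonZero (-i)) := fun i => by
      rw [pentagon_zero_apply, flip, zero_sub]
    rw [pentagon_succ_apply, e, e, e]
    refine (reflect_flip _ _ _).trans ?_
    refine ⟨1, one_ne_zero, ?_⟩
    rw [show pentagon (fun i => 3 - n (i + 1)) 0 (4 - j) =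
        reflect (pentagonZero 0) (pentagonZero 1) (pentagonZero (j + 1)) by
      rw [pentagon_zero_apply, show (0 : ZMod 5) - (4 - j) = j + 1 by
        rw [show (4 : ZMod 5) = -1 by decide]; ring]]
    rw [← reflect_outer_mul, ← pentagonZero_eq, ← pentagonZero_eq, ← pentagonZero_eq, reflect_comm]
    simp only [zero_add, Complex.ofReal_one, one_mul]
    congr 2 <;> congr 1 <;> ring
  | succ k ih =>
    have ih' := ih fun i h1 h2 => hn i h1 (by omega)
    rw [pentagon_succ_apply]
    refine ((ih' _).reflect (ih' _) (ih' _)).trans ?_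
    refine (reflect_flip _ _ _).trans ⟨1, one_ne_zero, ?_⟩
    rw [reflect_outer_mul, reflect_comm]
    rw [pentagon_succ_apply (fun i => 3 - n (i + 1))]
    have h3 := hn (k + 1 + 1) (by omega) le_rfl
    -- The bound by 3 keeps the natural subtraction from being truncated, so it agrees with
    -- subtraction modulo 5.
    rw [Nat.cast_sub h3, Complex.ofReal_one, one_mul]
    push_cast
    have e4 : (4 : ZMod 5) = -1 := by decide
    have e3 : (3 : ZMod 5) = -2 := by decide
    rw [e4, e3]
    congr 3 <;> congr 1 <;> ring

/-- The last index names a vertex and becomes `4 - n`, while the earlier ones name edges and become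
`3 - n`; the first index survives only in the rotation. -/
lemma α_proportional (k : ℕ) (n : ℕ → ℕ) (hn : ∀ i, 1 ≤ i → i ≤ k + 2 → n i ≤ 3) :
    Proportional (α (k + 2) n) (flip (outer (n 1 + 1) *
      α (k + 1) fun i => if i + 1 = k + 2 then 4 - n (k + 2) else 3 - n (i + 1))) := by
  refine (α_succ n (k + 1)).trans ?_
  refine (pentagon_succ_proportional n k (fun i h1 h2 => hn i (by omega) (by omega)) _).trans ?_
  refine Proportional.flip ?_
  obtain ⟨c, hc, h⟩ := α_succ (fun i => if i + 1 = k + 2 then 4 - n (k + 2) else 3 - n (i + 1)) k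
  refine ⟨c⁻¹, inv_ne_zero hc, ?_⟩
  rw [h]
  have h3 := hn (k + 2) (by omega) le_rfl
  have hc' : (c : ℂ) ≠ 0 := by exact_mod_cast hc
  rw [if_pos rfl, Nat.cast_sub (by omega : n (k + 2) ≤ 4)]
  -- The exceptional value at `k + 1` is invisible here, since this pentagon depends only on the
  -- first `k` indices.
  rw [pentagon_congr (n := fun i => if i + 1 = k + 2 then 4 - n (k + 2) else 3 - n (i + 1))
    (n' := fun i => 3 - n (i + 1)) fun i h1 h2 => if_neg (by omega)]
  push_cast
  field_simp

/-! ## The induction -/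

/-- A nontrivial rotation moves the sector into the complementary arc, which the reflection then
maps back into the open sector. The rotation by `outer 4` takes the end `q = 0` to the other end of
the sector, hence the extra condition. -/
lemma exists_outer_mul_dir {p q : ℝ} (hp : 0 < p) (hq : 0 ≤ q) {m : ZMod 5} (hm : m ≠ 0)
    (hmq : m = 4 → 0 < q) :
    ∃ c p' q' : ℝ, c ≠ 0 ∧ 0 < p' ∧ 0 < q' ∧ outer m * dir p q = c * dir p' (-q') := by
  have h := four_inr_sq
  have h' := inr_sq_add_half_sq
  have hi : 0 < 2 * inr := by linarith [inr_gt]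
  have hip := mul_pos hi hp
  have hiq := mul_nonneg hi.le hq
  have e2 : outer 2 = -(2 * inr) * outer 1 - outer 0 := by
    rw [outer_zero, outer_one, outer_two]
    apply Complex.ext <;> simp; linarith
  have e3 : outer 3 = 2 * inr * (outer 1 + outer 0) := by
    rw [outer_zero, outer_one, outer_three]
    apply Complex.ext <;> simp; linarith
  have e4 : outer 4 = -outer 1 - 2 * inr * outer 0 := by
    rw [outer_zero, outer_one, outer_four]
    apply Complex.ext <;> simp; linarith
  have hd : ∀ m, outer m * dir p q = Complex.I * (p * outer (m + 1) - q * outer m) := fun m => by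
    rw [outer_add, dir, outer_zero]
    ring
  rcases zmod_five_cases m with rfl | rfl | rfl | rfl | rfl
  · exact absurd rfl hm
  · refine ⟨-1, 2 * inr * p + q, p, by norm_num, by linarith, hp, ?_⟩
    rw [hd, show (1 : ZMod 5) + 1 = 2 by decide, e2, dir]
    push_cast
    ring
  · refine ⟨1, 2 * inr * p + 2 * inr * q, 2 * inr * p + q, by norm_num, by linarith,
      by linarith, ?_⟩
    rw [hd, show (2 : ZMod 5) + 1 = 3 by decide, e3, e2, dir]
    push_cast
    ring
  · refine ⟨-1, p + 2 * inr * q, 2 * inr * p + 2 * inr * q, by norm_num, by linarith,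
      by linarith, ?_⟩
    rw [hd, show (3 : ZMod 5) + 1 = 4 by decide, e3, e4, dir]
    push_cast
    ring
  · refine ⟨1, q, p + 2 * inr * q, by norm_num, hmq rfl, by linarith, ?_⟩
    rw [hd, show (4 : ZMod 5) + 1 = 0 by decide, e4, dir]
    push_cast
    ring

/-- The inductive step: rotate, which shifts labels by `m`, rescale, then reflect, which fills the
words. -/
lemma exists_isPair_flip {p q : ℝ} (hp : 0 < p) (hq : 0 ≤ q) {m : ZMod 5} (hm : m ≠ 0)
    (hmq : m = 4 → 0 < q) {v v' : ℂ} (hv' : Proportional v' (dir p q))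
    (hv : Proportional v (flip (outer m * v'))) {S L : List (ZMod 5)} (h : IsPair v' S L) :
    (∃ p' q' : ℝ, 0 < p' ∧ 0 < q' ∧ Proportional v (dir p' q')) ∧
      ∃ S' L', IsPair v S' L' ∧ S'.length < L'.length ∧
        reduce S' ~r S.map (· + m) ∧ reduce L' ~r L.map (· + m) := by
  obtain ⟨c, p', q', hc, hp', hq', e⟩ := exists_outer_mul_dir hp hq hm hmq
  obtain ⟨d, hd, rfl⟩ := hv'
  have hcd : d * c ≠ 0 := mul_ne_zero hd hc
  have e' : outer m * (d * dir p q) = (d * c : ℝ) * dir p' (-q') := by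
    push_cast
    linear_combination d * e
  have h1 := h.outer_mul m
  rw [e'] at h1
  have h2 := h1.mul (inv_ne_zero hcd)
  rw [← mul_assoc, ← Complex.ofReal_mul, inv_mul_cancel₀ hcd, Complex.ofReal_one, one_mul] at h2
  obtain ⟨h3, h4, h5, h6⟩ := isPair_dir hp' hq' h2
  have hv2 : Proportional v (dir p' q') := by
    refine hv.trans ⟨d * c * half, mul_ne_zero hcd half_pos.ne', ?_⟩
    rw [e', flip, reflect_mul, ← flip, flip_dir, neg_neg]
    push_cast
    ring
  refine ⟨⟨p', q', hp', hq', hv2⟩, _, _, ?_, h4, h5, h6⟩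
  obtain ⟨b, hb, rfl⟩ := hv2
  exact h3.mul hb

lemma natCast_add_one_ne_zero {i : ℕ} (hi : i ≤ 3) : (i + 1 : ZMod 5) ≠ 0 := by
  interval_cases i <;> decide

lemma exists_isPair_α (k : ℕ) : ∀ n : ℕ → ℕ, (∀ i, 1 ≤ i → i ≤ k + 1 → n i ≤ 3) →
    n (k + 1) ≠ 0 →
    (∃ p q : ℝ, 0 < p ∧ 0 < q ∧ Proportional (α (k + 1) n) (dir p q)) ∧
      ∃ S L, IsPair (α (k + 1) n) S L ∧ S.length < L.length := by
  induction k with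
  | zero =>
    intro n hn hn0
    have h3 := hn 1 le_rfl le_rfl
    -- With one index the rotation is by `n 1` itself, applied to the end `q = 0`; it must avoid
    -- both ends of the sector.
    have hm : (n 1 : ZMod 5) ≠ 0 ∧ (n 1 : ZMod 5) ≠ 4 := by
      have h0 : n 1 ≠ 0 := hn0
      interval_cases n 1 <;> first | omega | decide
    obtain ⟨h1, S, L, h2, h4, -⟩ := exists_isPair_flip (v := α 1 n) zero_lt_one le_rfl hm.1
      (fun h => absurd h hm.2) ⟨1, one_ne_zero, by simp [dir]⟩ (by
        refine (α_succ n 0).trans ⟨1, one_ne_zero, ?_⟩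
        have h := pentagonZero_eq (n 1) 0
        rw [zero_add, pentagon_zero_apply, h, flip, Complex.ofReal_one, one_mul, pentagonZero,
          sub_zero]) isPair_outer_one
    exact ⟨h1, S, L, h2, h4⟩
  | succ k ih =>
    intro n hn hn0
    have hk := hn (k + 2) (by omega) le_rfl
    obtain ⟨⟨p, q, hp, hq, h1⟩, S, L, h2, -⟩ := ih
      (fun i => if i + 1 = k + 2 then 4 - n (k + 2) else 3 - n (i + 1)) (by
        intro i h1 h2
        have : n (k + 2) ≠ 0 := hn0
        split_ifs <;> omega) (by
        rw [if_pos rfl]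
        omega)
    obtain ⟨h3, S', L', h4, h5, -⟩ := exists_isPair_flip hp hq.le
      (natCast_add_one_ne_zero (hn 1 le_rfl (by omega))) (fun _ => hq) h1 (α_proportional k n hn) h2
    exact ⟨h3, S', L', h4, h5⟩

/-! ### Recognizing short and long orbits -/

lemma IsPair.isShortOrbit_iff {v : ℂ} {S L : List (ZMod 5)} (h : IsPair v S L)
    (hlen : S.length < L.length) (w : List (ZMod 5)) : IsShortOrbit v w ↔ w ~r S := by
  simp only [IsShortOrbit, isSymbolicOrbit_iff, h.isOrbit_iff]
  constructor
  · rintro ⟨hw | hw, hmin⟩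
    · exact hw
    · have := hmin S (Or.inl (List.IsRotated.refl _))
      rw [hw.perm.length_eq] at this
      omega
  · intro hw
    refine ⟨Or.inl hw, ?_⟩
    rintro w' (hw' | hw') <;> rw [hw.perm.length_eq, hw'.perm.length_eq]
    exact hlen.le

lemma IsPair.isLongOrbit_iff {v : ℂ} {S L : List (ZMod 5)} (h : IsPair v S L)
    (hlen : S.length < L.length) (w : List (ZMod 5)) : IsLongOrbit v w ↔ w ~r L := by
  simp only [IsLongOrbit, isSymbolicOrbit_iff, h.isOrbit_iff]
  constructor
  · rintro ⟨hw | hw, hmax⟩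
    · have := hmax L (Or.inr (List.IsRotated.refl _))
      rw [hw.perm.length_eq] at this
      omega
    · exact hw
  · intro hw
    refine ⟨Or.inr hw, ?_⟩
    rintro w' (hw' | hw') <;> rw [hw.perm.length_eq, hw'.perm.length_eq]
    exact hlen.le

lemma shift_reduce_isRotated {i : ℕ} (hi : i ≤ 3) {w S S' : List (ZMod 5)} (hw : w ~r S')
    (h : reduce S' ~r S.map (· + (i + 1 : ZMod 5))) : shift (4 - i) (reduce w) ~r S := by
  -- Modulo 5 the shift by `4 - i` is the inverse of the label shift by `i + 1` caused by the
  -- rotation.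
  have e : ((4 - i : ℕ) : ZMod 5) = -(i + 1) := by
    rw [Nat.cast_sub (by omega)]
    push_cast
    rw [show (4 : ZMod 5) = -1 by decide]
    ring
  rw [shift, e, isRotated_map_add_iff]
  exact (reduce_isRotated hw).trans h

end

end DoublePentagon

theorem theorem6 (k : ℕ) (hk : 2 ≤ k) (n : ℕ → ℕ)
    (hn : ∀ i, 1 ≤ i → i ≤ k → n i ≤ 3) (hnk : n k ≠ 0) (w : List (ZMod 5)) :
    (DoublePentagon.IsShortOrbit (DoublePentagon.α k n) w →
      ∀ w' : List (ZMod 5),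
        DoublePentagon.IsShortOrbit
            (DoublePentagon.α (k - 1) fun i => if i + 1 = k then 4 - n k else 3 - n (i + 1)) w' ↔
          w' ~r DoublePentagon.shift (4 - n 1) (DoublePentagon.reduce w)) ∧
    (DoublePentagon.IsLongOrbit (DoublePentagon.α k n) w →
      ∀ w' : List (ZMod 5),
        DoublePentagon.IsLongOrbit
            (DoublePentagon.α (k - 1) fun i => if i + 1 = k then 4 - n k else 3 - n (i + 1)) w' ↔
          w' ~r DoublePentagon.shift (4 - n 1) (DoublePentagon.reduce w)) := by
  obtain ⟨k, rfl⟩ := Nat.exists_eq_add_of_le' hk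
  have h1 := hn 1 le_rfl (by omega)
  have h2 := hn (k + 2) (by omega) le_rfl
  -- The pair is constructed for the direction with fewer indices first; its last index `4 - n (k +
  -- 2)` is nonzero because `n (k + 2) ≤ 3`.
  obtain ⟨⟨p, q, hp, hq, hdir⟩, S, L, hpair, hlen⟩ := DoublePentagon.exists_isPair_α k
    (fun i => if i + 1 = k + 2 then 4 - n (k + 2) else 3 - n (i + 1)) (by
      intro i _ _
      split_ifs <;> omega) (by
      rw [if_pos rfl]
      omega)
  obtain ⟨-, S', L', hpair', hlen', hS, hL⟩ := DoublePentagon.exists_isPair_flip hp hq.le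
    (DoublePentagon.natCast_add_one_ne_zero h1) (fun _ => hq) hdir
    (DoublePentagon.α_proportional k n hn) hpair
  rw [show k + 2 - 1 = k + 1 by omega]
  constructor
  · intro hw w'
    have h3 := DoublePentagon.shift_reduce_isRotated h1 ((hpair'.isShortOrbit_iff hlen' w).1 hw) hS
    rw [hpair.isShortOrbit_iff hlen]
    exact ⟨fun h => h.trans h3.symm, fun h => h.trans h3⟩
  · intro hw w'
    have h3 := DoublePentagon.shift_reduce_isRotated h1 ((hpair'.isLongOrbit_iff hlen' w).1 hw) hL
    rw [hpair.isLongOrbit_iff hlen]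
    exact ⟨fun h => h.trans h3.symm, fun h => h.trans h3⟩
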